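/- **Setting.** Let $0<d<l$, $\Delta=[-l,-d]\cup[d,l]$, $p,m\ge 1$, $m=r+s$, $H=L^2(\Delta;\mathbb C^p)$. Elements of $\mathbb C^p,\mathbb C^m,\mathbb C^{2m}$ are row vectors and matrices act on them from the right. Let $J_1=\mathrm{diag}(I_r,0)$, $J_2=\mathrm{diag}(0,I_{s})$, $S_0=\begin{pmatrix}0&0\\ \widehat S&0\end{pmatrix}$, $L=J_1-J_2+S_0+S_0^*$, and let $\Pi$ be a measurable $p\times m$ matrix function on $\Delta$, with linearly independent rows at each point of a set of positive measure, such that $\widetilde\Pi=\Pi^*\Pi$ satisfies $\operatorname{tr}\widetilde\Pi=1$, $\widetilde\Pi J_1=J_1\widetilde\Pi$ and is Hölder continuous on $\Delta$ with an exponent in $(0,1]$. Let $B$ on $H$ be the triangular model of a coupling of a dissipative and an antidissipative operator, $$Bf(w)=wf(w)-i\!\int_{-l}^w\! f\chi_\Delta\Pi\, S_0^*\,\Pi^*(w)\,d\xi+i\!\int_w^l\! f\chi_\Delta\Pi\, S_0\,\Pi^*(w)\,d\xi+i\!\int_{-l}^w\! f\chi_\Delta\Pi\, L\,\Pi^*(w)\,d\xi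 .$$ Assume that $B$ is invertible and that $B^*=-UBU^*$ for a unitary $U$ on $H$. Put $A=B^{-1}$, $\Phi f=\int_\Delta f(w)\Pi(w)\,dw$, $\widetilde\Phi f=(\Phi f,\ \Phi (B^{-1})^*f)\in\mathbb C^{2m}$, $$\sigma_A=\begin{pmatrix}0&0\\0&-L\end{pmatrix},\quad \sigma_B=\begin{pmatrix}L&0\\0&0\end{pmatrix},\quad \gamma=\begin{pmatrix}0&-L\\-L&0\end{pmatrix},\quad \widetilde\gamma=\gamma+i(\sigma_A\widetilde\Phi\widetilde\Phi^*\sigma_B-\sigma_B\widetilde\Phi\widetilde\Phi^*\sigma_A),$$ $$T(x,t)=e^{i(-tA+xB)},\qquad T^{*-1}(x,t)=e^{i(-tA^*+xB^*)} .$$ Let $\rho,N,M_1,M,\widetilde B$ be bounded operators on $H$ with $$NB=BN,\quad N\widetilde B=N,\quad M\widetilde B=-M,\quad \widetilde B^2=I,\quad M_1=U^*,\quad M=\int_0^\infty e^{-ixB^*}\rho\,\tfrac{B-B^*}{i}\,e^{ixB}\,dx ,$$ the integral being a strong limit of $\int_0^R$ as $R\to\infty$. Put $\widetilde\rho=U^*\rho$,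 $P_1=\frac12(I+\widetilde B)$, $\Gamma(x,t)=T(x,t)N+M_1T^{*-1}(x,t)M$, $S(x,t)=\Gamma^{-1}(x,t)\Gamma_x(x,t)$ where $\Gamma$ is invertible, $v_h(\xi)=\widetilde\Phi e^{i\xi B}h$ (the mode of $h\in H$), and, for a bounded operator $\tau$ on $H$, $$\Psi_\tau(x,t)=\widetilde\Phi T(x,t)\,\tau\,\widetilde\Phi^*\sigma_B=\widetilde\Phi e^{i(-tA+xB)}\,\tau\,\widetilde\Phi^*\sigma_B,\qquad \Psi=\Psi_{\widetilde\rho}.$$ **Theorem.** (a) $(A=B^{-1},B;H,\widetilde\Phi,\mathbb C^{2m};\sigma_A,\sigma_B,\gamma,\widetilde\gamma)$ is a commutative regular colligation: $AB=BA$, $\sigma_A,\sigma_B,\gamma,\widetilde\gamma$ are selfadjoint, $(A-A^*)/i=\widetilde\Phi^*\sigma_A\widetilde\Phi$, $(B-B^*)/i=\widetilde\Phi^*\sigma_B\widetilde\Phi$, $\sigma_A\widetilde\Phi B^*-\sigma_B\widetilde\Phi A^*=\gamma\widetilde\Phi$, $\sigma_A\widetilde\Phi B-\sigma_B\widetilde\Phi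 A=\widetilde\gamma\widetilde\Phi$. (b) At every $(x,t)\in\mathbb R^2$ where $\Gamma(x,t)$ is invertible, $S(x,t)$ is invertible and satisfies the Sine-Gordon equation $$\frac{\partial}{\partial t}\Big(S^{-1}\frac{\partial}{\partial x}S\Big)=\widetilde BS^{-1}\widetilde BS-S^{-1}\widetilde BS\widetilde B .$$ (c) At every such $(x,t)$, for every $g\in G_B=(B-B^*)H$, put $h=h(x,t)=S(x,t)g-iBg$. Then for all $\xi\in\mathbb R$ $$v_{Nh}(\xi)=-\int_0^\infty\Psi(-2x+\xi+\eta,-2t)\,v_h(\eta)\,d\eta+\Psi(-2x+\xi,-2t)\,v_g(0);$$ in particular, in the normalization $N=P_1$, $$v_{P_1h}(\xi)=-\int_0^\infty\Psi(-2x+\xi+\eta,-2t)\,v_h(\eta)\,d\eta+\Psi(-2x+\xi,-2t)\,v_g(0).$$ More generally, if $N=\widehat NP_1$ with $\widehat N$ invertible and commuting with $B$, then the last equation holds with $\Psi=\Psi_{\widetilde\rho}$ replaced by $\Psi_{\widehat N^{-1}\widetilde\rho}$. All integrals $\int_0^\infty$ converge as limits of $\int_0^R$, $R\to\infty$. -/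

import Mathlib

open MeasureTheory Filter Topology ContinuousLinearMap
open scoped Matrix InnerProductSpace

noncomputable section

namespace SolitonGLM

/-! ### Matrices acting on row vectors from the right -/

/-- The operator `v ↦ v X` on row vectors, between the unitary spaces `ℂ^α` and `ℂ^β`. -/
def rowMul {α β : Type} [Fintype α] [Fintype β] (X : Matrix α β ℂ) :
    EuclideanSpace ℂ α →L[ℂ] EuclideanSpace ℂ β :=
  LinearMap.toContinuousLinearMap
    { toFun := fun v => WithLp.toLp 2 (v.ofLp ᵥ* X)
      map_add' := fun v w => by ext j; simp [Matrix.add_vecMul]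
      map_smul' := fun c v => by ext j; simp [Matrix.smul_vecMul] }

theorem rowMul_apply {α β : Type} [Fintype α] [Fintype β] (X : Matrix α β ℂ)
    (v : EuclideanSpace ℂ α) : rowMul X v = WithLp.toLp 2 (v.ofLp ᵥ* X) := rfl

theorem norm_rowMul_le {α β : Type} [Fintype α] [Fintype β] (X : Matrix α β ℂ) (K : ℝ)
    (hX : ∀ i j, ‖X i j‖ ≤ K) (v : EuclideanSpace ℂ α) :
    ‖rowMul X v‖ ≤ (Fintype.card β * (Fintype.card α * K)) * ‖v‖ := by
  classical
  have h1 : ‖rowMul X v‖ ≤ ∑ j, ‖(rowMul X v) j‖ := by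
    conv_lhs => rw [← (EuclideanSpace.basisFun β ℂ).sum_repr (rowMul X v)]
    refine (norm_sum_le _ _).trans (Finset.sum_le_sum fun j _ => ?_)
    simp [norm_smul]
  refine h1.trans ?_
  have h2 : ∀ j, ‖(rowMul X v) j‖ ≤ Fintype.card α * K * ‖v‖ := by
    intro j
    have : (rowMul X v) j = ∑ i, v i * X i j := by
      simp [rowMul_apply, Matrix.vecMul, dotProduct]
    rw [this]
    refine (norm_sum_le _ _).trans ?_
    have : ∀ i ∈ Finset.univ, ‖v i * X i j‖ ≤ K * ‖v‖ := by
      intro i _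
      rw [norm_mul, mul_comm]
      exact mul_le_mul (hX i j) (PiLp.norm_apply_le v i) (norm_nonneg _)
        ((norm_nonneg _).trans (hX i j))
    refine (Finset.sum_le_sum this).trans ?_
    simp [mul_assoc]
  refine (Finset.sum_le_sum fun j _ => h2 j).trans ?_
  simp [mul_assoc]

theorem aestronglyMeasurable_rowMul {α β : Type} [Fintype α] [Fintype β] {μ : Measure ℝ}
    {X : ℝ → Matrix α β ℂ} {v : ℝ → EuclideanSpace ℂ α}
    (hX : ∀ i j, AEMeasurable (fun w => X w i j) μ) (hv : AEStronglyMeasurable v μ) :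
    AEStronglyMeasurable (fun w => rowMul (X w) (v w)) μ := by
  refine (PiLp.continuous_toLp 2 _).comp_aestronglyMeasurable
    (g := fun x : β → ℂ => (WithLp.toLp 2 x : EuclideanSpace ℂ β))
    (f := fun w => (v w).ofLp ᵥ* X w) ?_
  refine (aemeasurable_pi_lambda _ fun j => ?_).aestronglyMeasurable
  simp only [Matrix.vecMul, dotProduct]
  refine Finset.aemeasurable_fun_sum _ fun i _ => AEMeasurable.mul ?_ (hX i j)
  exact ((EuclideanSpace.proj (𝕜 := ℂ) i).continuous.comp_aestronglyMeasurable hv).aemeasurable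

/-! ### The triangular model on `L²([-l,-d] ∪ [d,l]; ℂ^p)` -/

/-- `Δ = [-l,-d] ∪ [d,l]`. -/
def Delta (l d : ℝ) : Set ℝ := Set.Icc (-l) (-d) ∪ Set.Icc d l

theorem measurableSet_Delta (l d : ℝ) : MeasurableSet (Delta l d) :=
  measurableSet_Icc.union measurableSet_Icc

/-- Lebesgue measure on `Δ`. -/
def muDelta (l d : ℝ) : Measure ℝ := volume.restrict (Delta l d)

instance (l d : ℝ) : IsFiniteMeasure (muDelta l d) := by
  refine ⟨?_⟩
  rw [muDelta, Measure.restrict_apply_univ, Delta]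
  refine (measure_union_le _ _).trans_lt ?_
  simp

/-- The Hilbert space `L²(Δ; ℂ^p)`. -/
abbrev HSpace (l d : ℝ) (p : ℕ) : Type := Lp (EuclideanSpace ℂ (Fin p)) 2 (muDelta l d)

/-- The signature matrix `J₁ = diag(I_r, 0)`; here `m = r + s`. -/
def J₁ (r s : ℕ) : Matrix (Fin r ⊕ Fin s) (Fin r ⊕ Fin s) ℂ := Matrix.fromBlocks 1 0 0 0

/-- The signature matrix `J₂ = diag(0, I_{m-r})`. -/
def J₂ (r s : ℕ) : Matrix (Fin r ⊕ Fin s) (Fin r ⊕ Fin s) ℂ := Matrix.fromBlocks 0 0 0 1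

/-- The data of a triangular model on `Δ` with `m = r + s` channels: the off-diagonal block of
`S` and the `p × m` matrix function `Π`. -/
structure ModelData (l d : ℝ) (p r s : ℕ) where
  /-- the lower left block `Ŝ` of `S` -/
  Shat : Matrix (Fin s) (Fin r) ℂ
  /-- the matrix function `Π` -/
  P : ℝ → Matrix (Fin p) (Fin r ⊕ Fin s) ℂ
  measurable_P : ∀ i j, AEMeasurable (fun w => P w i j) (muDelta l d)
  /-- the rows of `Π(w)` are linearly independent on a set of positive measure -/
  rows_indep : ∃ F : Set ℝ, F ⊆ Delta l d ∧ MeasurableSet F ∧ 0 < volume F ∧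
    ∀ w ∈ F, LinearIndependent ℂ (fun i => P w i)
  trace_eq_one : ∀ w ∈ Delta l d, ((P w)ᴴ * P w).trace = 1
  commute_J₁ : ∀ w ∈ Delta l d, ((P w)ᴴ * P w) * J₁ r s = J₁ r s * ((P w)ᴴ * P w)
  /-- `Π*Π` is Hölder continuous on `Δ` -/
  holder : ∃ C > 0, ∃ a : ℝ, 0 < a ∧ a ≤ 1 ∧ ∀ w₁ ∈ Delta l d, ∀ w₂ ∈ Delta l d, ∀ i j,
    ‖((P w₁)ᴴ * P w₁) i j - ((P w₂)ᴴ * P w₂) i j‖ ≤ C * |w₁ - w₂| ^ a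

variable {l d : ℝ} {p r s : ℕ}

namespace ModelData

/-- `S = [[0, 0], [Ŝ, 0]]`. -/
def S (D : ModelData l d p r s) : Matrix (Fin r ⊕ Fin s) (Fin r ⊕ Fin s) ℂ :=
  Matrix.fromBlocks 0 0 D.Shat 0

/-- `L = J₁ - J₂ + S + S*`. -/
def L (D : ModelData l d p r s) : Matrix (Fin r ⊕ Fin s) (Fin r ⊕ Fin s) ℂ :=
  J₁ r s - J₂ r s + D.S + D.Sᴴ

theorem norm_P_le (D : ModelData l d p r s) {w : ℝ} (hw : w ∈ Delta l d) (i j) :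
    ‖D.P w i j‖ ≤ 1 := by
  have h := D.trace_eq_one w hw
  have h2 : ((D.P w)ᴴ * D.P w).trace = ((∑ b, ∑ a, ‖D.P w a b‖ ^ 2 : ℝ) : ℂ) := by
    simp only [Matrix.trace, Matrix.diag, Matrix.mul_apply, Matrix.conjTranspose_apply]
    push_cast
    refine Finset.sum_congr rfl fun b _ => Finset.sum_congr rfl fun a _ => ?_
    rw [RCLike.star_def, RCLike.conj_mul]
    simp
  rw [h2] at h
  have h3 : (∑ b, ∑ a, ‖D.P w a b‖ ^ 2 : ℝ) = 1 := by exact_mod_cast h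
  have h4 : ‖D.P w i j‖ ^ 2 ≤ 1 := by
    rw [← h3]
    refine le_trans ?_ (Finset.single_le_sum (f := fun b => ∑ a, ‖D.P w a b‖ ^ 2)
      (fun b _ => Finset.sum_nonneg fun a _ => by positivity) (Finset.mem_univ j))
    exact Finset.single_le_sum (f := fun a => ‖D.P w a j‖ ^ 2)
      (fun a _ => by positivity) (Finset.mem_univ i)
  nlinarith [norm_nonneg (D.P w i j)]

/-- The function `ξ ↦ f(ξ) χ_Δ(ξ) Π(ξ)`. -/
def channel (D : ModelData l d p r s) (f : HSpace l d p) (ξ : ℝ) :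
    EuclideanSpace ℂ (Fin r ⊕ Fin s) :=
  (Delta l d).indicator (fun ξ => rowMul (D.P ξ) (f ξ)) ξ

theorem integrable_channel_restrict (D : ModelData l d p r s) (f : HSpace l d p) :
    Integrable (fun ξ => rowMul (D.P ξ) (f ξ)) (muDelta l d) := by
  have hf : Integrable (fun ξ => f ξ) (muDelta l d) :=
    (Lp.memLp f).integrable (by norm_num)
  refine Integrable.mono'
    (hf.norm.const_mul (Fintype.card (Fin r ⊕ Fin s) * (Fintype.card (Fin p) * 1) : ℝ))
    (aestronglyMeasurable_rowMul D.measurable_P hf.aestronglyMeasurable) ?_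
  filter_upwards [ae_restrict_mem (measurableSet_Delta l d)] with w hw
  exact norm_rowMul_le _ _ (fun i j => D.norm_P_le hw i j) _

theorem integrable_channel (D : ModelData l d p r s) (f : HSpace l d p) :
    Integrable (D.channel f) :=
  (integrable_indicator_iff (measurableSet_Delta l d)).2 (D.integrable_channel_restrict f)

theorem channel_add (D : ModelData l d p r s) (f g : HSpace l d p) :
    D.channel (f + g) =ᵐ[volume] fun ξ => D.channel f ξ + D.channel g ξ := by
  have h : ∀ᵐ ξ ∂volume, ξ ∈ Delta l d → (f + g : HSpace l d p) ξ = f ξ + g ξ :=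
    (ae_restrict_iff' (measurableSet_Delta l d)).1 (Lp.coeFn_add f g)
  filter_upwards [h] with ξ hξ
  by_cases hm : ξ ∈ Delta l d
  · simp only [channel, Set.indicator_of_mem hm]
    rw [hξ hm]
    simp only [map_add]
  · simp [channel, hm]

theorem channel_smul (D : ModelData l d p r s) (c : ℂ) (f : HSpace l d p) :
    D.channel (c • f) =ᵐ[volume] fun ξ => c • D.channel f ξ := by
  have h : ∀ᵐ ξ ∂volume, ξ ∈ Delta l d → (c • f : HSpace l d p) ξ = c • f ξ :=
    (ae_restrict_iff' (measurableSet_Delta l d)).1 (Lp.coeFn_smul c f)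
  filter_upwards [h] with ξ hξ
  by_cases hm : ξ ∈ Delta l d
  · simp only [channel, Set.indicator_of_mem hm]
    rw [hξ hm]
    simp only [map_smul]
  · simp [channel, hm]

theorem exists_integral_norm_channel_le (D : ModelData l d p r s) :
    ∃ K : ℝ, 0 ≤ K ∧ ∀ f : HSpace l d p, ∫ ξ, ‖D.channel f ξ‖ ≤ K * ‖f‖ := by
  refine ⟨(Fintype.card (Fin r ⊕ Fin s) * (Fintype.card (Fin p) * 1) : ℝ) *
        (muDelta l d).real Set.univ ^ (2⁻¹ : ℝ), by positivity, fun f => ?_⟩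
  have hf : MemLp (fun ξ => f ξ) 1 (muDelta l d) :=
    (Lp.memLp f).mono_exponent (by norm_num)
  have h1 : ∫ ξ, ‖f ξ‖ ∂(muDelta l d) ≤ (muDelta l d).real Set.univ ^ (2⁻¹ : ℝ) * ‖f‖ := by
    have h2 := eLpNorm_le_eLpNorm_mul_rpow_measure_univ (p := 1) (q := 2) (μ := muDelta l d)
      (f := fun ξ => f ξ) (by norm_num) (Lp.aestronglyMeasurable f)
    have h3 := ENNReal.toReal_mono ?_ h2
    · rw [eLpNorm_one_eq_lintegral_enorm,
        ← integral_norm_eq_lintegral_enorm hf.aestronglyMeasurable, ENNReal.toReal_mul,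
        ← ENNReal.toReal_rpow] at h3
      rw [mul_comm, Lp.norm_def, measureReal_def]
      convert h3 using 3
      norm_num
    · refine ENNReal.mul_ne_top (Lp.memLp f).2.ne ?_
      exact ENNReal.rpow_ne_top_of_nonneg (by norm_num) (measure_ne_top _ _)
  have h4 : ∫ ξ, ‖D.channel f ξ‖ = ∫ ξ, ‖rowMul (D.P ξ) (f ξ)‖ ∂(muDelta l d) := by
    unfold muDelta
    rw [← integral_indicator (measurableSet_Delta l d)]
    simp only [channel, norm_indicator_eq_indicator_norm]
    rfl
  rw [h4, mul_assoc]
  refine le_trans (integral_mono_ae (D.integrable_channel_restrict f).norm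
    ((hf.integrable le_rfl).norm.const_mul
      (Fintype.card (Fin r ⊕ Fin s) * (Fintype.card (Fin p) * 1) : ℝ)) ?_) ?_
  · filter_upwards [ae_restrict_mem (measurableSet_Delta l d)] with w hw
    exact norm_rowMul_le _ _ (fun i j => D.norm_P_le hw i j) _
  · rw [integral_const_mul]
    gcongr

/-- `Φ f = ∫_Δ f(w) Π(w) dw`. -/
def Phi (D : ModelData l d p r s) : HSpace l d p →L[ℂ] EuclideanSpace ℂ (Fin r ⊕ Fin s) :=
  LinearMap.mkContinuousOfExistsBound
    { toFun := fun f => ∫ w, D.channel f w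
      map_add' := fun f g => by
        rw [integral_congr_ae (D.channel_add f g),
          integral_add (D.integrable_channel f) (D.integrable_channel g)]
      map_smul' := fun c f => by
        rw [integral_congr_ae (D.channel_smul c f), integral_smul, RingHom.id_apply] }
    (by
      obtain ⟨K, -, hK⟩ := D.exists_integral_norm_channel_le
      exact ⟨K, fun f => (norm_integral_le_integral_norm _).trans (hK f)⟩)

/-- The function `w ↦ (∫_{a(w)}^{b(w)} f(ξ) χ_Δ(ξ) Π(ξ) dξ) C Π*(w)`. -/
def volterraFun (D : ModelData l d p r s) (a b : ℝ → ℝ)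
    (C : Matrix (Fin r ⊕ Fin s) (Fin r ⊕ Fin s) ℂ) (f : HSpace l d p) (w : ℝ) :
    EuclideanSpace ℂ (Fin p) :=
  rowMul (C * (D.P w)ᴴ) (∫ ξ in (a w)..(b w), D.channel f ξ)

theorem exists_norm_CP_le (D : ModelData l d p r s)
    (C : Matrix (Fin r ⊕ Fin s) (Fin r ⊕ Fin s) ℂ) :
    ∃ K : ℝ, 0 ≤ K ∧ ∀ w ∈ Delta l d, ∀ i j, ‖(C * (D.P w)ᴴ) i j‖ ≤ K := by
  refine ⟨∑ i, ∑ k, ‖C i k‖, by positivity, fun w hw i j => ?_⟩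
  rw [Matrix.mul_apply]
  refine (norm_sum_le _ _).trans ?_
  refine le_trans (Finset.sum_le_sum (g := fun k => ‖C i k‖) fun k _ => ?_)
    (Finset.single_le_sum (f := fun i => ∑ k, ‖C i k‖) (fun i _ => by positivity)
      (Finset.mem_univ i))
  rw [norm_mul, Matrix.conjTranspose_apply, norm_star]
  exact mul_le_of_le_one_right (norm_nonneg _) (D.norm_P_le hw j k)

theorem aestronglyMeasurable_volterraFun (D : ModelData l d p r s) {a b : ℝ → ℝ}
    (ha : Continuous a) (hb : Continuous b)
    (C : Matrix (Fin r ⊕ Fin s) (Fin r ⊕ Fin s) ℂ) (f : HSpace l d p) :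
    AEStronglyMeasurable (D.volterraFun a b C f) (muDelta l d) := by
  refine aestronglyMeasurable_rowMul (fun i j => ?_) ?_
  · simp only [Matrix.mul_apply, Matrix.conjTranspose_apply]
    refine Finset.aemeasurable_fun_sum _ fun k _ => ?_
    exact aemeasurable_const.mul
      (Complex.continuous_conj.measurable.comp_aemeasurable (D.measurable_P j k))
  · have hi : ∀ x y, IntervalIntegrable (D.channel f) volume x y :=
      fun x y => (D.integrable_channel f).intervalIntegrable
    have hc := intervalIntegral.continuous_primitive hi 0
    have : (fun w => ∫ ξ in (a w)..(b w), D.channel f ξ) =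
        fun w => (∫ ξ in (0 : ℝ)..(b w), D.channel f ξ) - ∫ ξ in (0 : ℝ)..(a w), D.channel f ξ := by
      funext w
      rw [intervalIntegral.integral_interval_sub_left (hi _ _) (hi _ _)]
    rw [this]
    exact ((hc.comp hb).sub (hc.comp ha)).aestronglyMeasurable

theorem exists_norm_volterraFun_le (D : ModelData l d p r s) (a b : ℝ → ℝ)
    (C : Matrix (Fin r ⊕ Fin s) (Fin r ⊕ Fin s) ℂ) :
    ∃ K : ℝ, 0 ≤ K ∧ ∀ f : HSpace l d p, ∀ᵐ w ∂(muDelta l d),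
      ‖D.volterraFun a b C f w‖ ≤ K * ‖f‖ := by
  obtain ⟨K₁, h₁, hK₁⟩ := D.exists_integral_norm_channel_le
  obtain ⟨K₂, h₂, hK₂⟩ := D.exists_norm_CP_le C
  refine ⟨(Fintype.card (Fin p) * (Fintype.card (Fin r ⊕ Fin s) * K₂)) * K₁, by positivity,
    fun f => ?_⟩
  filter_upwards [ae_restrict_mem (measurableSet_Delta l d)] with w hw
  refine (norm_rowMul_le _ _ (fun i j => hK₂ w hw i j) _).trans ?_
  rw [mul_assoc _ K₁]
  gcongr
  refine (intervalIntegral.norm_integral_le_integral_norm_uIoc).trans ?_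
  refine le_trans ?_ (hK₁ f)
  exact setIntegral_le_integral (D.integrable_channel f).norm
    (Filter.Eventually.of_forall fun _ => norm_nonneg _)

theorem memLp_volterraFun (D : ModelData l d p r s) {a b : ℝ → ℝ}
    (ha : Continuous a) (hb : Continuous b)
    (C : Matrix (Fin r ⊕ Fin s) (Fin r ⊕ Fin s) ℂ) (f : HSpace l d p) :
    MemLp (D.volterraFun a b C f) 2 (muDelta l d) := by
  obtain ⟨K, -, hK⟩ := D.exists_norm_volterraFun_le a b C
  exact MemLp.of_bound (D.aestronglyMeasurable_volterraFun ha hb C f) _ (hK f)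

/-- The bounded operator `f ↦ (w ↦ (∫_{a(w)}^{b(w)} f(ξ) χ_Δ(ξ) Π(ξ) dξ) C Π*(w))`. -/
def volterra (D : ModelData l d p r s) (a b : ℝ → ℝ) (ha : Continuous a) (hb : Continuous b)
    (C : Matrix (Fin r ⊕ Fin s) (Fin r ⊕ Fin s) ℂ) : HSpace l d p →L[ℂ] HSpace l d p :=
  LinearMap.mkContinuousOfExistsBound
    { toFun := fun f => (D.memLp_volterraFun ha hb C f).toLp
      map_add' := fun f g => by
        rw [← MemLp.toLp_add]
        refine MemLp.toLp_congr _ _ (Filter.Eventually.of_forall fun w => ?_)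
        simp only [volterraFun, Pi.add_apply, ← map_add]
        rw [← intervalIntegral.integral_add (D.integrable_channel f).intervalIntegrable
          (D.integrable_channel g).intervalIntegrable]
        congr 1
        exact intervalIntegral.integral_congr_ae
          ((D.channel_add f g).mono fun ξ h _ => h)
      map_smul' := fun c f => by
        rw [RingHom.id_apply, ← MemLp.toLp_const_smul]
        refine MemLp.toLp_congr _ _ (Filter.Eventually.of_forall fun w => ?_)
        simp only [volterraFun, Pi.smul_apply, ← map_smul]
        rw [← intervalIntegral.integral_smul]
        congr 1
        exact intervalIntegral.integral_congr_ae
          ((D.channel_smul c f).mono fun ξ h _ => h) }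
    (by
      obtain ⟨K, hK0, hK⟩ := D.exists_norm_volterraFun_le a b C
      refine ⟨(muDelta l d).real Set.univ ^ (2 : ENNReal).toReal⁻¹ * K, fun f => ?_⟩
      rw [mul_assoc]
      refine Lp.norm_le_of_ae_bound (by positivity) ?_
      filter_upwards [(D.memLp_volterraFun ha hb C f).coeFn_toLp, hK f] with w h1 h2
      simpa only [LinearMap.coe_mk, AddHom.coe_mk, h1] using h2)

end ModelData

theorem abs_le_of_mem_Delta {l d w : ℝ} (hw : w ∈ Delta l d) : |w| ≤ |l| + |d| := by
  rw [Delta, Set.mem_union, Set.mem_Icc, Set.mem_Icc] at hw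
  have h1 := le_abs_self l
  have h2 := neg_abs_le l
  have h3 := le_abs_self d
  have h4 := neg_abs_le d
  rw [abs_le]
  rcases hw with hw | hw <;> constructor <;> linarith [hw.1, hw.2, abs_nonneg l, abs_nonneg d]

theorem memLp_mulFun (f : HSpace l d p) :
    MemLp (fun w : ℝ => (w : ℂ) • f w) 2 (muDelta l d) := by
  refine MemLp.of_le_mul (c := |l| + |d|) (Lp.memLp f) ?_ ?_
  · exact (Complex.continuous_ofReal.aestronglyMeasurable).smul (Lp.aestronglyMeasurable f)
  · filter_upwards [ae_restrict_mem (measurableSet_Delta l d)] with w hw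
    rw [norm_smul, Complex.norm_real, Real.norm_eq_abs]
    gcongr
    exact abs_le_of_mem_Delta hw

/-- Multiplication by the independent variable, `f(w) ↦ w f(w)`. -/
def mulVar (l d : ℝ) (p : ℕ) : HSpace l d p →L[ℂ] HSpace l d p :=
  LinearMap.mkContinuousOfExistsBound
    { toFun := fun f => (memLp_mulFun f).toLp
      map_add' := fun f g => by
        rw [← MemLp.toLp_add]
        refine MemLp.toLp_congr _ _ ?_
        filter_upwards [Lp.coeFn_add f g] with w hw
        rw [hw, Pi.add_apply, Pi.add_apply, smul_add]
      map_smul' := fun c f => by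
        rw [RingHom.id_apply, ← MemLp.toLp_const_smul]
        refine MemLp.toLp_congr _ _ ?_
        filter_upwards [Lp.coeFn_smul c f] with w hw
        rw [hw, Pi.smul_apply, Pi.smul_apply, smul_comm] }
    (by
      refine ⟨|l| + |d|, fun f => ?_⟩
      refine Lp.norm_le_mul_norm_of_ae_le_mul ?_
      filter_upwards [(memLp_mulFun f).coeFn_toLp,
        ae_restrict_mem (measurableSet_Delta l d)] with w h1 hw
      simp only [LinearMap.coe_mk, AddHom.coe_mk, h1]
      rw [norm_smul, Complex.norm_real, Real.norm_eq_abs]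
      gcongr
      exact abs_le_of_mem_Delta hw)

namespace ModelData

/-- The triangular model (coupling)
`Bf(w) = w f(w) - i ∫_{-l}^w f Π S* Π*(w) dξ + i ∫_w^l f Π S Π*(w) dξ + i ∫_{-l}^w f Π L Π*(w) dξ`
on `L²(Δ; ℂ^p)`. -/
def B (D : ModelData l d p r s) : HSpace l d p →L[ℂ] HSpace l d p :=
  mulVar l d p
    - Complex.I • D.volterra (fun _ => -l) (fun w => w) continuous_const continuous_id' D.Sᴴ
    + Complex.I • D.volterra (fun w => w) (fun _ => l) continuous_id' continuous_const D.S
    + Complex.I • D.volterra (fun _ => -l) (fun w => w) continuous_const continuous_id' D.L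

/-- `A = B⁻¹` (used only for invertible `B`). -/
def A (D : ModelData l d p r s) : HSpace l d p →L[ℂ] HSpace l d p := Ring.inverse D.B

/-- The external space `E = ℂ^{2m}`. -/
abbrev E (r s : ℕ) : Type := EuclideanSpace ℂ ((Fin r ⊕ Fin s) ⊕ (Fin r ⊕ Fin s))

/-- `Φ̃ f = (Φ f, Φ (B⁻¹)* f)`. -/
def PhiT (D : ModelData l d p r s) : HSpace l d p →L[ℂ] E r s :=
  (PiLp.continuousLinearEquiv 2 ℂ fun _ : (Fin r ⊕ Fin s) ⊕ (Fin r ⊕ Fin s) => ℂ).symm.toContinuousLinearMap ∘L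
    ContinuousLinearMap.pi (Sum.elim
      (fun k => EuclideanSpace.proj k ∘L D.Phi)
      (fun k => EuclideanSpace.proj k ∘L D.Phi ∘L adjoint D.A))

/-- `σ_A = [[0, 0], [0, -L]]`. -/
def sigmaA (D : ModelData l d p r s) : E r s →L[ℂ] E r s :=
  rowMul (Matrix.fromBlocks 0 0 0 (-D.L))

/-- `σ_B = [[L, 0], [0, 0]]`. -/
def sigmaB (D : ModelData l d p r s) : E r s →L[ℂ] E r s :=
  rowMul (Matrix.fromBlocks D.L 0 0 0)

/-- `γ = [[0, -L], [-L, 0]]`. -/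
def gamma (D : ModelData l d p r s) : E r s →L[ℂ] E r s :=
  rowMul (Matrix.fromBlocks 0 (-D.L) (-D.L) 0)

/-- `γ̃ = γ + i (σ_A Φ̃ Φ̃* σ_B - σ_B Φ̃ Φ̃* σ_A)`. -/
def gammaT (D : ModelData l d p r s) : E r s →L[ℂ] E r s :=
  D.gamma + Complex.I • (D.sigmaA ∘L D.PhiT ∘L adjoint D.PhiT ∘L D.sigmaB
    - D.sigmaB ∘L D.PhiT ∘L adjoint D.PhiT ∘L D.sigmaA)

end ModelData

/-! ### Colligations, collective motions and solitonic combinations -/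

section Abstract

variable {H : Type*} [NormedAddCommGroup H] [InnerProductSpace ℂ H] [CompleteSpace H]
variable {E : Type*} [NormedAddCommGroup E] [InnerProductSpace ℂ E] [CompleteSpace E]

/-- `X = (A, B; H, Φ, E; σ_A, σ_B, γ, γ̃)` is a commutative regular colligation. -/
structure IsRegularColligation (A B : H →L[ℂ] H) (Φ : H →L[ℂ] E)
    (σA σB γ γt : E →L[ℂ] E) : Prop where
  comm : A ∘L B = B ∘L A
  selfAdjoint_σA : IsSelfAdjoint σA
  selfAdjoint_σB : IsSelfAdjoint σB
  selfAdjoint_γ : IsSelfAdjoint γ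
  selfAdjoint_γt : IsSelfAdjoint γt
  im_A : Complex.I⁻¹ • (A - adjoint A) = adjoint Φ ∘L σA ∘L Φ
  im_B : Complex.I⁻¹ • (B - adjoint B) = adjoint Φ ∘L σB ∘L Φ
  input : σA ∘L Φ ∘L adjoint B - σB ∘L Φ ∘L adjoint A = γ ∘L Φ
  output : σA ∘L Φ ∘L B - σB ∘L Φ ∘L A = γt ∘L Φ
  link : γt - γ = Complex.I • (σA ∘L Φ ∘L adjoint Φ ∘L σB - σB ∘L Φ ∘L adjoint Φ ∘L σA)

/-- The collective motion `T(x,t) = exp(i(ε t A + δ x B))` with `ε = -1`, `δ = 1`. -/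
def motion (A B : H →L[ℂ] H) (x t : ℝ) : H →L[ℂ] H :=
  NormedSpace.exp (Complex.I • (-(t : ℂ) • A + (x : ℂ) • B))

/-- The collective motion `T*⁻¹(x,t) = exp(i(ε̄ t A* + δ̄ x B*))` with `ε = -1`, `δ = 1`. -/
def adjMotion (A B : H →L[ℂ] H) (x t : ℝ) : H →L[ℂ] H :=
  NormedSpace.exp (Complex.I • (-(t : ℂ) • adjoint A + (x : ℂ) • adjoint B))

/-- `Γ(x,t) = T(x,t) N + M₁ T*⁻¹(x,t) M`. -/
def Gam (A B N M₁ M : H →L[ℂ] H) (x t : ℝ) : H →L[ℂ] H :=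
  motion A B x t ∘L N + M₁ ∘L adjMotion A B x t ∘L M

/-- The solitonic combination `S(x,t) = Γ⁻¹(x,t) Γ_x(x,t)` (meant where `Γ(x,t)` is
invertible). -/
def soliton (A B N M₁ M : H →L[ℂ] H) (x t : ℝ) : H →L[ℂ] H :=
  Ring.inverse (Gam A B N M₁ M x t) ∘L deriv (fun y : ℝ => Gam A B N M₁ M y t) x

/-- At the point `(x,t)` the operator function `S` has an invertible value, is differentiable in
`x` (also for all nearby values of the time), and satisfies the Sine-Gordon equation
`∂_t (S⁻¹ ∂_x S) = B̃ S⁻¹ B̃ S - S⁻¹ B̃ S B̃`. -/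
def SineGordonAt (Bt : H →L[ℂ] H) (S : ℝ → ℝ → H →L[ℂ] H) (x t : ℝ) : Prop :=
  IsUnit (S x t) ∧
  (∀ᶠ τ in 𝓝 t, DifferentiableAt ℝ (fun y : ℝ => S y τ) x) ∧
  HasDerivAt (fun τ : ℝ => Ring.inverse (S x τ) ∘L deriv (fun y : ℝ => S y τ) x)
    (Bt ∘L Ring.inverse (S x t) ∘L Bt ∘L S x t
      - Ring.inverse (S x t) ∘L Bt ∘L S x t ∘L Bt) t

/-- `M = ∫_0^∞ exp(-ixB*) ρ ((B - B*)/i) exp(ixB) dx`, as a strong limit of `∫_0^R`. -/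
def IsStrongIntegral (B ρ M : H →L[ℂ] H) : Prop :=
  ∀ f : H, Tendsto
    (fun R : ℝ => ∫ x in (0 : ℝ)..R,
      NormedSpace.exp (-(Complex.I * (x : ℂ)) • adjoint B)
        (ρ ((Complex.I⁻¹ • (B - adjoint B)) (NormedSpace.exp ((Complex.I * (x : ℂ)) • B) f))))
    atTop (𝓝 (M f))

/-- The mode `v_h(ξ) = Φ exp(iξB) h` of the element `h`. -/
def mode (B : H →L[ℂ] H) (Φ : H →L[ℂ] E) (h : H) (ξ : ℝ) : E :=
  Φ (NormedSpace.exp ((Complex.I * (ξ : ℂ)) • B) h)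

/-- `Ψ(x,t) = Φ T(x,t) ρ̃ Φ* σ_B = Φ exp(i(-tA + xB)) ρ̃ Φ* σ_B`. -/
def Psi (A B : H →L[ℂ] H) (Φ : H →L[ℂ] E) (σB : E →L[ℂ] E) (ρt : H →L[ℂ] H) (x t : ℝ) :
    E →L[ℂ] E :=
  Φ ∘L motion A B x t ∘L ρt ∘L adjoint Φ ∘L σB

/-- `P₁ = (I + B̃)/2`. -/
def P₁ (Bt : H →L[ℂ] H) : H →L[ℂ] H := (2⁻¹ : ℂ) • (1 + Bt)

/-- The generalized Gelfand-Levitan-Marchenko equation at the point `(x,t)`, for all `ξ`: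
the improper integral `∫_0^∞ Ψ(-2x+ξ+η,-2t) v_h(η) dη` converges and
`v_k(ξ) = -∫_0^∞ Ψ(-2x+ξ+η,-2t) v_h(η) dη + Ψ(-2x+ξ,-2t) v_g(0)`. -/
def GLMEquation (A B : H →L[ℂ] H) (Φ : H →L[ℂ] E) (σB : E →L[ℂ] E) (ρt : H →L[ℂ] H)
    (x t : ℝ) (k h g : H) : Prop :=
  ∀ ξ : ℝ, ∃ J : E,
    Tendsto (fun R : ℝ => ∫ η in (0 : ℝ)..R,
      Psi A B Φ σB ρt (-2 * x + ξ + η) (-2 * t) (mode B Φ h η)) atTop (𝓝 J) ∧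
    mode B Φ k ξ = -J + Psi A B Φ σB ρt (-2 * x + ξ) (-2 * t) (mode B Φ g 0)

end Abstract

end SolitonGLM

end

noncomputable section

namespace SolitonGLM

/-! ### Operator exponentials and the collective motions -/

section Abstract

variable {H : Type*} [NormedAddCommGroup H] [InnerProductSpace ℂ H] [CompleteSpace H]
variable {E : Type*} [NormedAddCommGroup E] [InnerProductSpace ℂ E] [CompleteSpace E]

/-! Everything rests on U*B* = -BU*, and hence U*A* = -AU*: the operator U* carries T*⁻¹ to T⁻¹, so
Γ = TN + T⁻¹M₁M. Since NB̃ = N and MB̃ = -M, the signs match in both terms and Γ_x = iBΓB̃, Γ_t =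
-iAΓB̃. These two linear equations together with AB = I and B̃² = I already give Sine-Gordon
(`sineGordonAt_of_hasDerivAt`): S = iΓ⁻¹BΓB̃ has an explicit inverse, S⁻¹S_x = -S + B̃SB̃ and S_t =
I - B̃S⁻¹B̃S.

For the Gelfand-Levitan-Marchenko equation, convergence of the integral M forces the Lyapunov
identity B*M - MB = -iZ with Z = ρ(B - B*)/i (`lyapunov_of_tendsto`). If h = Sg - iBg, then Γh =
i(BΓB̃ - ΓB)g; the N-part cancels because N commutes with B, and Lyapunov leaves TNh + T⁻¹M₁Mh =
T⁻¹M₁Zg. Applying Φ̃e^{iξB}T⁻¹, writing M as its integral and factoring (B - B*)/i = Φ̃*σ_BΦ̃ turns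
this into the equation for the modes (`glmEquation_of_factor`).

The concrete model enters only through the colligation (`isRegularColligation`). By Fubini the
adjoint of a left Volterra operator is a right one, and a left and a right one with the same matrix
C add up to Φ*CΦ. Hence B - B* = iΦ*LΦ, and the remaining relations are algebra with A = B⁻¹. -/

theorem exp_add_of_commute {X Y : H →L[ℂ] H} (h : Commute X Y) :
    NormedSpace.exp (X + Y) = NormedSpace.exp X * NormedSpace.exp Y := by
  let +nondep : NormedAlgebra ℚ (H →L[ℂ] H) := .restrictScalars ℚ ℂ (H →L[ℂ] H)
  exact NormedSpace.exp_add_of_commute h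

theorem semiconjBy_exp {Z X Y : H →L[ℂ] H} (h : SemiconjBy Z X Y) :
    SemiconjBy Z (NormedSpace.exp X) (NormedSpace.exp Y) := by
  let +nondep : NormedAlgebra ℚ (H →L[ℂ] H) := .restrictScalars ℚ ℂ (H →L[ℂ] H)
  exact h.exp_right

theorem motion_zero (A B : H →L[ℂ] H) : motion A B 0 0 = 1 := by
  simp [motion, NormedSpace.exp_zero]

theorem motion_add {A B : H →L[ℂ] H} (hAB : Commute A B) (x t x' t' : ℝ) :
    motion A B (x + x') (t + t') = motion A B x t * motion A B x' t' := by
  rw [motion, motion, motion, ← exp_add_of_commute]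
  · congr 1
    push_cast
    module
  · have hA : Commute A (-(t' : ℂ) • A + (x' : ℂ) • B) :=
      ((Commute.refl A).smul_right _).add_right (hAB.smul_right _)
    have hB : Commute B (-(t' : ℂ) • A + (x' : ℂ) • B) :=
      (hAB.symm.smul_right _).add_right ((Commute.refl B).smul_right _)
    exact (((hA.smul_left _).add_left (hB.smul_left _)).smul_left _).smul_right _

theorem motion_time_zero (A B : H →L[ℂ] H) (x : ℝ) :
    motion A B x 0 = NormedSpace.exp ((Complex.I * (x : ℂ)) • B) := by
  simp only [motion, Complex.ofReal_zero, neg_zero, zero_smul, zero_add, smul_smul]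

theorem motion_space_zero (A B : H →L[ℂ] H) (t : ℝ) :
    motion A B 0 t = NormedSpace.exp (t • (-(Complex.I • A))) := by
  rw [motion]
  congr 1
  rw [← Complex.coe_smul]
  push_cast
  module

theorem commute_motion {A B Z : H →L[ℂ] H} (hA : Commute Z A) (hB : Commute Z B) (x t : ℝ) :
    Commute Z (motion A B x t) :=
  semiconjBy_exp (((hA.smul_right _).add_right (hB.smul_right _)).smul_right _)

theorem hasDerivAt_exp_smul (X : H →L[ℂ] H) (x : ℝ) :
    HasDerivAt (fun y : ℝ => NormedSpace.exp (y • X)) (X * NormedSpace.exp (x • X)) x :=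
  hasDerivAt_exp_smul_const' (𝕂 := ℝ) X x

theorem hasDerivAt_motion_space {A B : H →L[ℂ] H} (hAB : Commute A B) (x t : ℝ) :
    HasDerivAt (fun y : ℝ => motion A B y t) (Complex.I • (B * motion A B x t)) x := by
  -- By commutativity the time factor splits off, so only a one-parameter group has to be
  -- differentiated.
  have h : ∀ y : ℝ, motion A B y t =
      NormedSpace.exp (y • (Complex.I • B)) * motion A B 0 t := fun y => by
    have h1 := motion_add hAB y 0 0 t
    rw [add_zero, zero_add, motion_time_zero] at h1
    rw [h1, ← Complex.coe_smul, smul_smul, mul_comm Complex.I]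
  rw [funext h]
  refine ((hasDerivAt_exp_smul (Complex.I • B) x).mul_const (motion A B 0 t)).congr_deriv ?_
  rw [smul_mul_assoc, smul_mul_assoc, mul_assoc, ← h]

theorem hasDerivAt_motion_time {A B : H →L[ℂ] H} (hAB : Commute A B) (x t : ℝ) :
    HasDerivAt (fun τ : ℝ => motion A B x τ) (-(Complex.I • (A * motion A B x t))) t := by
  have h : ∀ τ : ℝ, motion A B x τ =
      NormedSpace.exp (τ • (-(Complex.I • A))) * motion A B x 0 := fun τ => by
    have h1 := motion_add hAB 0 τ x 0
    rwa [add_zero, zero_add, motion_space_zero] at h1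
  rw [funext h]
  refine ((hasDerivAt_exp_smul (-(Complex.I • A)) t).mul_const (motion A B x 0)).congr_deriv ?_
  rw [neg_mul, neg_mul, smul_mul_assoc, smul_mul_assoc, mul_assoc]

theorem adjMotion_eq_motion (A B : H →L[ℂ] H) (x t : ℝ) :
    adjMotion A B x t = motion (adjoint A) (adjoint B) x t := rfl

/-- The anti-intertwining reverses the sign of the exponent. For Z = M₁ this replaces the adjoint
motion by the inverse motion. -/
theorem mul_adjMotion {A B Z : H →L[ℂ] H} (hA : Z * adjoint A = -(A * Z))
    (hB : Z * adjoint B = -(B * Z)) (x t : ℝ) :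
    Z * adjMotion A B x t = motion A B (-x) (-t) * Z := by
  refine (semiconjBy_exp ?_).eq
  rw [SemiconjBy, mul_smul_comm, smul_mul_assoc, mul_add, add_mul, mul_smul_comm, mul_smul_comm,
    smul_mul_assoc, smul_mul_assoc, hA, hB]
  push_cast
  module

/-! ### The Sine-Gordon equation for logarithmic derivatives -/

theorem hasDerivAt_ring_inverse {g : ℝ → H →L[ℂ] H} {g' : H →L[ℂ] H} {x : ℝ}
    (hg : HasDerivAt g g' x) (hx : IsUnit (g x)) :
    HasDerivAt (fun y => Ring.inverse (g y))
      (-(Ring.inverse (g x) * g' * Ring.inverse (g x))) x := by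
  obtain ⟨u, hu⟩ := hx
  have h1 := hasFDerivAt_ringInverse (𝕜 := ℝ) u
  rw [hu] at h1
  refine (h1.comp_hasDerivAt x hg).congr_deriv ?_
  rw [← hu, Ring.inverse_unit]
  rfl

/-- If `G_x = iBGB̃` and `G_t = -iB⁻¹GB̃` with `B̃² = 1`, then `G⁻¹G_x` solves the Sine-Gordon
equation wherever `G` is invertible. -/
theorem sineGordonAt_of_hasDerivAt {A B Bt : H →L[ℂ] H} {G : ℝ → ℝ → H →L[ℂ] H}
    (hAB : A * B = 1) (hBA : B * A = 1) (hBt : Bt * Bt = 1)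
    (hx : ∀ x t, HasDerivAt (fun y => G y t) (Complex.I • (B * G x t * Bt)) x)
    (ht : ∀ x t, HasDerivAt (fun τ => G x τ) (-(Complex.I • (A * G x t * Bt))) t)
    {x t : ℝ} (hG : IsUnit (G x t)) :
    SineGordonAt Bt (fun x t => Ring.inverse (G x t) ∘L deriv (fun y => G y t) x) x t := by
  -- The derivative of G is known everywhere, so this explicit formula is an identity of functions
  -- even where G is not invertible.
  set S : ℝ → ℝ → H →L[ℂ] H := fun x t => Ring.inverse (G x t) * (Complex.I • (B * G x t * Bt))
    with hS
  have hfun : (fun x t => Ring.inverse (G x t) ∘L deriv (fun y => G y t) x) = S := by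
    funext x t
    rw [(hx x t).deriv]
    rfl
  rw [hfun]
  have hII : Complex.I * Complex.I = -1 := Complex.I_mul_I
  clear_value S
  -- The candidate for S⁻¹: the factors of iG⁻¹BGB̃ inverted in reverse order, with i⁻¹ = -i and
  -- B̃⁻¹ = B̃.
  set R : ℝ → ℝ → H →L[ℂ] H := fun x t =>
    -(Complex.I • (Bt * Ring.inverse (G x t) * A * G x t)) with hR
  clear_value R
  have hSR : ∀ x t, IsUnit (G x t) → S x t * R x t = 1 := fun x t h => by
    simp only [hS, hR, mul_neg, mul_smul_comm, smul_mul_assoc, smul_smul, hII]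
    simp only [neg_smul, one_smul, neg_neg, mul_assoc]
    rw [← mul_assoc Bt Bt, hBt, one_mul, ← mul_assoc (G x t), Ring.mul_inverse_cancel _ h, one_mul,
      ← mul_assoc B A, hBA, one_mul, Ring.inverse_mul_cancel _ h]
  have hRS : ∀ x t, IsUnit (G x t) → R x t * S x t = 1 := fun x t h => by
    simp only [hS, hR, neg_mul, smul_neg, mul_smul_comm, smul_mul_assoc, smul_smul, hII]
    simp only [neg_smul, one_smul, neg_neg, mul_assoc]
    rw [← mul_assoc (G x t), Ring.mul_inverse_cancel _ h, one_mul,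
      ← mul_assoc A B, hAB, one_mul, ← mul_assoc _ (G x t), Ring.inverse_mul_cancel _ h, one_mul,
      hBt]
  have hunit : ∀ x t, IsUnit (G x t) → IsUnit (S x t) := fun x t h =>
    ⟨⟨S x t, R x t, hSR x t h, hRS x t h⟩, rfl⟩
  have hinv : ∀ x t, IsUnit (G x t) → Ring.inverse (S x t) = R x t := fun x t h =>
    Ring.inverse_unit ⟨S x t, R x t, hSR x t h, hRS x t h⟩
  have hd : ∀ {f : ℝ → H →L[ℂ] H} {f' : H →L[ℂ] H} {x : ℝ}, HasDerivAt f f' x →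
      HasDerivAt (fun y => Complex.I • (B * f y * Bt)) (Complex.I • (B * f' * Bt)) x :=
    fun hf => ((hf.const_mul B).mul_const Bt).const_smul Complex.I
  -- Product rule: G_x = GS gives -S² from the derivative of G⁻¹, and iG⁻¹BG = SB̃ turns the other
  -- term into SB̃SB̃.
  have hSx : ∀ x t, IsUnit (G x t) →
      HasDerivAt (fun y => S y t) (-(S x t * S x t) + S x t * Bt * S x t * Bt) x := fun x t h => by
    have h1 := (hasDerivAt_ring_inverse (hx x t) h).mul (hd (hx x t))
    rw [hS]
    refine h1.congr_deriv ?_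
    congr 1
    · simp only [mul_smul_comm, smul_mul_assoc, smul_smul, mul_assoc, hII]
      rw [← mul_assoc Bt Bt, hBt, one_mul, ← mul_assoc (G x t) (Ring.inverse _),
        Ring.mul_inverse_cancel _ h, one_mul]
  -- The summand 1 comes from BA = 1: in iG⁻¹BG_tB̃ everything cancels. In the other term iG⁻¹AG =
  -- -B̃R.
  have hSt : HasDerivAt (fun τ => S x τ) (-(Bt * R x t * Bt * S x t) + 1) t := by
    have h1 := (hasDerivAt_ring_inverse (ht x t) hG).mul (hd (ht x t))
    rw [hS]
    refine h1.congr_deriv ?_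
    congr 1
    · simp only [hR, neg_mul, mul_neg, smul_neg, mul_smul_comm, smul_mul_assoc, mul_assoc]
      rw [← mul_assoc Bt Bt, hBt, one_mul]
    · simp only [neg_mul, mul_neg, mul_smul_comm, smul_mul_assoc, smul_smul, mul_assoc, smul_neg,
        hII]
      rw [hBt, mul_one, ← mul_assoc B A, hBA, one_mul, Ring.inverse_mul_cancel _ hG, neg_smul,
        one_smul, neg_neg]
  -- Invertibility is an open condition, so the formulas for S⁻¹ and S_x hold at all nearby times
  -- and may be differentiated in time.
  have hev : ∀ᶠ τ in 𝓝 t, IsUnit (G x τ) :=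
    (ht x t).continuousAt.eventually (Units.isOpen.mem_nhds hG)
  refine ⟨hunit x t hG, hev.mono fun τ h => (hSx x τ h).differentiableAt, ?_⟩
  -- This function is S⁻¹S_x; in its time derivative the constants -1 and B̃·1·B̃ = 1 cancel.
  have h2 : HasDerivAt (fun τ => -S x τ + Bt * S x τ * Bt)
      (Bt * R x t * Bt * S x t - R x t * Bt * S x t * Bt) t := by
    refine (hSt.neg.add ((hSt.const_mul Bt).mul_const Bt)).congr_deriv ?_
    simp only [mul_add, add_mul, mul_neg, neg_mul, mul_one, hBt, mul_assoc]
    rw [← mul_assoc Bt Bt, hBt, one_mul]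
    abel
  have h3 : HasDerivAt (fun τ : ℝ => Ring.inverse (S x τ) ∘L deriv (fun y : ℝ => S y τ) x)
      (Bt * R x t * Bt * S x t - R x t * Bt * S x t * Bt) t := by
    refine h2.congr_of_eventuallyEq (hev.mono fun τ h => ?_)
    change Ring.inverse (S x τ) * deriv (fun y : ℝ => S y τ) x = _
    rw [(hSx x τ h).deriv, hinv x τ h, mul_add, mul_neg]
    simp only [← mul_assoc, hRS x τ h, one_mul]
  refine h3.congr_deriv ?_
  rw [hinv x t hG]
  simp only [← ContinuousLinearMap.mul_def, mul_assoc]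

/-- Right multiplication by B̃ fixes the N-term and changes the sign of the M-term, which
compensates the sign from moving B* through M₁. So both terms obey one linear equation. -/
theorem hasDerivAt_Gam_space {A B N M₁ M Bt : H →L[ℂ] H} (hAB : Commute A B)
    (hB : M₁ * adjoint B = -(B * M₁)) (hN : N * Bt = N) (hMB : M * Bt = -M) (x t : ℝ) :
    HasDerivAt (fun y => Gam A B N M₁ M y t)
      (Complex.I • (B * Gam A B N M₁ M x t * Bt)) x := by
  have hAB' : Commute (adjoint A) (adjoint B) := hAB.star_star
  have h1 := ((hasDerivAt_motion_space hAB x t).mul_const N).add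
    (((hasDerivAt_motion_space hAB' x t).mul_const M).const_mul M₁)
  refine h1.congr_deriv ?_
  change _ = Complex.I • (B * (motion A B x t * N + M₁ * (adjMotion A B x t * M)) * Bt)
  simp only [adjMotion_eq_motion, smul_mul_assoc, mul_smul_comm, mul_add, add_mul, mul_assoc, hN,
    hMB, mul_neg, smul_add]
  rw [← mul_assoc M₁ (adjoint B), hB]
  simp only [neg_mul, mul_assoc, smul_neg]

theorem hasDerivAt_Gam_time {A B N M₁ M Bt : H →L[ℂ] H} (hAB : Commute A B)
    (hA : M₁ * adjoint A = -(A * M₁)) (hN : N * Bt = N) (hMB : M * Bt = -M) (x t : ℝ) :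
    HasDerivAt (fun τ => Gam A B N M₁ M x τ)
      (-(Complex.I • (A * Gam A B N M₁ M x t * Bt))) t := by
  have hAB' : Commute (adjoint A) (adjoint B) := hAB.star_star
  have h1 := ((hasDerivAt_motion_time hAB x t).mul_const N).add
    (((hasDerivAt_motion_time hAB' x t).mul_const M).const_mul M₁)
  refine h1.congr_deriv ?_
  change _ = -(Complex.I • (A * (motion A B x t * N + M₁ * (adjMotion A B x t * M)) * Bt))
  simp only [adjMotion_eq_motion, smul_mul_assoc, mul_smul_comm, mul_add, add_mul, mul_assoc, hN,
    hMB, mul_neg, neg_mul, smul_add, neg_add]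
  rw [← mul_assoc M₁ (adjoint A), hA]
  simp only [neg_mul, mul_assoc, smul_neg]

/-! ### Strong integrals and the Lyapunov equation -/

/-- A function on `[0, ∞)` with a limit at infinity whose integrals over `[0, R]` converge tends
to zero. -/
theorem tendsto_zero_of_tendsto_intervalIntegral {F : ℝ → E} {a b : E} (hF : Continuous F)
    (ha : Tendsto F atTop (𝓝 a))
    (hb : Tendsto (fun R : ℝ => ∫ x in (0 : ℝ)..R, F x) atTop (𝓝 b)) : a = 0 := by
  by_contra hne
  have hpos : 0 < ‖a‖ := norm_pos_iff.2 hne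
  -- The integral over the unit window [R, R + 1] tends to zero, yet for large R it lies within
  -- ‖a‖/2 of a.
  have h1 : Tendsto (fun R : ℝ => (∫ x in (0 : ℝ)..(R + 1), F x) - ∫ x in (0 : ℝ)..R, F x)
      atTop (𝓝 0) := by
    simpa using (hb.comp (tendsto_atTop_add_const_right _ 1 tendsto_id)).sub hb
  have h2 : ∀ᶠ R in atTop, ∀ x ≥ R, ‖F x - a‖ ≤ ‖a‖ / 2 := by
    have := (tendsto_iff_norm_sub_tendsto_zero.1 ha).eventually (ge_mem_nhds (half_pos hpos))
    exact eventually_forall_ge_atTop.2 this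
  have h3 : ∀ᶠ R in atTop, ‖a‖ / 2 ≤
      ‖(∫ x in (0 : ℝ)..(R + 1), F x) - ∫ x in (0 : ℝ)..R, F x‖ := by
    filter_upwards [h2] with R hR
    rw [intervalIntegral.integral_interval_sub_left (hF.intervalIntegrable _ _)
      (hF.intervalIntegrable _ _)]
    have h4 : ‖∫ x in R..(R + 1), (F x - a)‖ ≤ ‖a‖ / 2 * |R + 1 - R| :=
      intervalIntegral.norm_integral_le_of_norm_le_const fun x hx =>
        hR x (by rw [Set.uIoc_of_le (by linarith)] at hx; exact hx.1.le)
    rw [intervalIntegral.integral_sub (hF.intervalIntegrable _ _) (by simp),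
      intervalIntegral.integral_const] at h4
    simp only [add_sub_cancel_left, abs_one, mul_one, one_smul] at h4
    have h6 := norm_sub_norm_le a (∫ x in R..(R + 1), F x)
    rw [norm_sub_rev a] at h6
    linarith
  have h7 := ge_of_tendsto h1.norm h3
  rw [norm_zero] at h7
  linarith

/-- The integrand `exp(-ixB*) Z exp(ixB)` of a strong integral. -/
def integrand (B Z : H →L[ℂ] H) (x : ℝ) : H →L[ℂ] H :=
  NormedSpace.exp (-(Complex.I * (x : ℂ)) • adjoint B) * Z *
    NormedSpace.exp ((Complex.I * (x : ℂ)) • B)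

theorem hasDerivAt_integrand (B Z : H →L[ℂ] H) (x : ℝ) :
    HasDerivAt (integrand B Z)
      (-(Complex.I • (adjoint B * integrand B Z x - integrand B Z x * B))) x := by
  have e1 : ∀ y : ℝ, -(Complex.I * (y : ℂ)) • adjoint B = y • (-(Complex.I • adjoint B)) :=
    fun y => by rw [← Complex.coe_smul]; module
  have e2 : ∀ y : ℝ, (Complex.I * (y : ℂ)) • B = y • (Complex.I • B) :=
    fun y => by rw [← Complex.coe_smul]; module
  have h1 : HasDerivAt (fun y : ℝ => NormedSpace.exp (-(Complex.I * (y : ℂ)) • adjoint B))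
      (-(Complex.I • adjoint B) * NormedSpace.exp (-(Complex.I * (x : ℂ)) • adjoint B)) x := by
    simp only [e1]
    exact hasDerivAt_exp_smul _ x
  have h2 : HasDerivAt (fun y : ℝ => NormedSpace.exp ((Complex.I * (y : ℂ)) • B))
      (NormedSpace.exp ((Complex.I * (x : ℂ)) • B) * (Complex.I • B)) x := by
    simp only [e2]
    exact hasDerivAt_exp_smul_const (𝕂 := ℝ) _ x
  refine ((h1.mul_const Z).mul h2).congr_deriv ?_
  simp only [integrand, neg_mul, smul_mul_assoc, mul_smul_comm, smul_sub, neg_sub, mul_assoc]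
  abel

theorem continuous_integrand (B Z : H →L[ℂ] H) : Continuous (integrand B Z) :=
  continuous_iff_continuousAt.2 fun x => (hasDerivAt_integrand B Z x).continuousAt

theorem integrand_zero (B Z : H →L[ℂ] H) : integrand B Z 0 = Z := by
  simp [integrand, NormedSpace.exp_zero]

/-- The Lyapunov equation of a convergent strong integral. -/
theorem lyapunov_of_tendsto {B Z M : H →L[ℂ] H}
    (hM : ∀ f, Tendsto (fun R : ℝ => ∫ x in (0 : ℝ)..R, integrand B Z x f) atTop (𝓝 (M f))) :
    adjoint B * M - M * B = -(Complex.I • Z) := by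
  ext f
  have hc : ∀ g, Continuous fun x => integrand B Z x g := fun g =>
    (continuous_integrand B Z).clm_apply continuous_const
  have hBc : Continuous fun x => adjoint B (integrand B Z x f) :=
    (adjoint B).continuous.comp (hc f)
  -- The integrated differential equation of the integrand. The term with B on the right is the same
  -- strong integral at the vector Bf, so the right side converges as R → ∞ and the limit of the
  -- integrand must be zero.
  have h1 : ∀ R : ℝ, integrand B Z R f = Z f - Complex.I • (adjoint B
      (∫ x in (0 : ℝ)..R, integrand B Z x f) - ∫ x in (0 : ℝ)..R, integrand B Z x (B f)) :=
    fun R => by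
    have hd : ∀ x : ℝ, HasDerivAt (fun x => integrand B Z x f)
        (-(Complex.I • (adjoint B (integrand B Z x f) - integrand B Z x (B f)))) x := fun x => by
      exact ((ContinuousLinearMap.apply ℂ H f).restrictScalars ℝ).hasFDerivAt.comp_hasDerivAt x
        (hasDerivAt_integrand B Z x)
    have hi := intervalIntegral.integral_eq_sub_of_hasDerivAt (a := 0) (b := R)
      (fun x _ => hd x) (Continuous.intervalIntegrable
        ((hBc.sub (hc (B f))).const_smul Complex.I).neg _ _)
    rw [intervalIntegral.integral_neg, intervalIntegral.integral_smul,
      intervalIntegral.integral_sub (hBc.intervalIntegrable _ _)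
        ((hc (B f)).intervalIntegrable _ _),
      ContinuousLinearMap.intervalIntegral_comp_comm _ ((hc f).intervalIntegrable _ _),
      integrand_zero] at hi
    rw [sub_eq_add_neg, hi]
    abel
  have h2 : Tendsto (fun R => integrand B Z R f) atTop
      (𝓝 (Z f - Complex.I • (adjoint B (M f) - M (B f)))) := by
    rw [funext h1]
    exact tendsto_const_nhds.sub
      (((((adjoint B).continuous.tendsto _).comp (hM f)).sub (hM (B f))).const_smul _)
  have h3 := tendsto_zero_of_tendsto_intervalIntegral (hc f) h2 (hM f)
  have h4 : Complex.I • (adjoint B (M f) - M (B f)) = Z f := (sub_eq_zero.1 h3).symm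
  simp only [sub_apply, neg_apply, smul_apply, mul_apply_eq_comp]
  rw [← h4, smul_smul, Complex.I_mul_I, neg_smul, one_smul, neg_neg]

/-! ### The Gelfand-Levitan-Marchenko equation -/

/-- The equation for the modes of the solitonic combination, with the normalizing operator `Q`
cancelled from `N = QK`. -/
theorem glmEquation_of_factor {A B N M₁ M Bt ρ Q Q' K : H →L[ℂ] H} {Φ : H →L[ℂ] E}
    {σB : E →L[ℂ] E} (hAB : A * B = 1) (hBA : B * A = 1)
    (hA : M₁ * adjoint A = -(A * M₁)) (hB : M₁ * adjoint B = -(B * M₁))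
    (hΦ : Complex.I⁻¹ • (B - adjoint B) = adjoint Φ ∘L σB ∘L Φ)
    (hM : IsStrongIntegral B ρ M) (hNB : N * B = B * N) (hN : N * Bt = N) (hMB : M * Bt = -M)
    (hQQ : Q' * Q = 1) (hQA : Commute Q' A) (hQB : Commute Q' B) (hK : N = Q * K)
    {x t : ℝ} (hG : IsUnit (Gam A B N M₁ M x t)) (g h : H)
    (hh : h = soliton A B N M₁ M x t g - Complex.I • B g) :
    GLMEquation A B Φ σB (Q' * (M₁ * ρ)) x t (K h) h g := by
  have hAB' : Commute A B := hAB.trans hBA.symm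
  set Z : H →L[ℂ] H := ρ * (Complex.I⁻¹ • (B - adjoint B)) with hZ
  have hM' : ∀ f, Tendsto (fun R : ℝ => ∫ x in (0 : ℝ)..R, integrand B Z x f) atTop
      (𝓝 (M f)) := hM
  have hT : ∀ x t, M₁ * adjMotion A B x t = motion A B (-x) (-t) * M₁ := mul_adjMotion hA hB
  set G := Gam A B N M₁ M x t with hGdef
  have hGeq : G = motion A B x t * N + motion A B (-x) (-t) * M₁ * M := by
    rw [← hT, mul_assoc]
    rfl
  -- the action of `Γ` on `h`
  have hGh : G h = (motion A B (-x) (-t) * M₁ * Z) g := by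
    have h1 : G h = (Complex.I • (B * G * Bt - G * B)) g := by
      rw [hh, map_sub, soliton, (hasDerivAt_Gam_space hAB' hB hN hMB x t).deriv]
      rw [← ContinuousLinearMap.mul_def, ← mul_apply_eq_comp, ← mul_assoc, ← hGdef,
        Ring.mul_inverse_cancel _ hG, one_mul]
      simp [smul_sub]
    rw [h1]
    congr 1
    -- The N-part drops out because T and N commute with B. In the M-part the signs from BM₁ = -M₁B*
    -- and MB̃ = -M cancel.
    have h2 : B * G * Bt - G * B = motion A B (-x) (-t) * M₁ * (adjoint B * M - M * B) := by
      have h3 : B * motion A B (-x) (-t) = motion A B (-x) (-t) * B :=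
        commute_motion hAB'.symm (Commute.refl B) _ _
      have h4 : B * motion A B x t = motion A B x t * B :=
        commute_motion hAB'.symm (Commute.refl B) _ _
      have h5 : B * (motion A B (-x) (-t) * M₁ * M) =
          -(motion A B (-x) (-t) * M₁ * (adjoint B * M)) := by
        rw [← mul_assoc, ← mul_assoc, h3, mul_assoc _ B, mul_assoc _ M₁, ← mul_assoc M₁, hB]
        simp [mul_assoc]
      rw [hGeq, mul_add, add_mul, add_mul, h5, mul_assoc B, mul_assoc (motion A B x t), hN,
        ← mul_assoc B, h4, mul_assoc _ N B, hNB, mul_sub]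
      simp only [neg_mul, mul_assoc, hMB, mul_neg, neg_neg]
      abel
    rw [h2, lyapunov_of_tendsto hM', mul_neg, mul_smul_comm, smul_neg, smul_smul,
      Complex.I_mul_I, neg_smul, one_smul, neg_neg]
  have hmul : ∀ ξ : ℝ, motion A B (-2 * x + ξ) (-2 * t) =
      motion A B ξ 0 * (motion A B (-x) (-t) * motion A B (-x) (-t)) := fun ξ => by
    rw [← motion_add hAB', ← motion_add hAB']
    congr 1 <;> ring
  have hinv : motion A B (-x) (-t) * motion A B x t = 1 := by
    rw [← motion_add hAB', neg_add_cancel, neg_add_cancel, motion_zero]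
  have hQT : ∀ x t, Q' * motion A B x t = motion A B x t * Q' := commute_motion hQA hQB
  intro ξ
  -- The value of the improper integral: the bounded operator ΦT(-2x+ξ, -2t)Q'M₁ comes out, and the
  -- remaining strong integral is Mh.
  refine ⟨Φ ((motion A B (-2 * x + ξ) (-2 * t) * (Q' * (M₁ * M))) h), ?_, ?_⟩
  · have hc : Continuous fun η => integrand B Z η h :=
      (continuous_integrand B Z).clm_apply continuous_const
    have hint : ∀ R : ℝ, ∫ η in (0 : ℝ)..R, Psi A B Φ σB (Q' * (M₁ * ρ)) (-2 * x + ξ + η) (-2 * t)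
        (mode B Φ h η) = (Φ ∘L (motion A B (-2 * x + ξ) (-2 * t) * (Q' * M₁)))
          (∫ η in (0 : ℝ)..R, integrand B Z η h) := fun R => by
      rw [← ContinuousLinearMap.intervalIntegral_comp_comm _ (hc.intervalIntegrable _ _)]
      refine intervalIntegral.integral_congr fun η _ => ?_
      have hexp : M₁ * NormedSpace.exp (-(Complex.I * (η : ℂ)) • adjoint B) =
          motion A B η 0 * M₁ := by
        have := hT (-η) 0
        rw [adjMotion_eq_motion, motion_time_zero, neg_neg, neg_zero] at this
        rw [← this]
        push_cast
        rw [mul_neg]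
      -- The factor e^{-iηB*} of the integrand becomes e^{iηB} on passing M₁, which shifts the space
      -- argument of the motion by η.
      have hop : motion A B (-2 * x + ξ + η) (-2 * t) * (Q' * (M₁ * ρ)) *
          (adjoint Φ ∘L σB ∘L Φ) * NormedSpace.exp ((Complex.I * (η : ℂ)) • B) =
          motion A B (-2 * x + ξ) (-2 * t) * (Q' * M₁) * integrand B Z η := by
        have e := motion_add hAB' (-2 * x + ξ) (-2 * t) η 0
        rw [add_zero] at e
        rw [← hΦ, e, integrand, hZ]
        simp only [mul_assoc]
        rw [← mul_assoc M₁ (NormedSpace.exp _), hexp, ← mul_assoc Q' (motion A B η 0 * M₁),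
          ← mul_assoc Q' (motion A B η 0), hQT]
        simp only [mul_assoc]
      exact congrArg Φ (DFunLike.congr_fun hop h)
    simp only [hint]
    have := ((Φ ∘L (motion A B (-2 * x + ξ) (-2 * t) * (Q' * M₁))).continuous.tendsto _).comp
      (hM' h)
    exact this
  · have h6 : motion A B (-2 * x + ξ) (-2 * t) * (Q' * (M₁ * Z)) =
        motion A B ξ 0 * Q' * motion A B (-x) (-t) * (motion A B (-x) (-t) * M₁ * Z) := by
      rw [hmul, mul_assoc _ Q', hQT]
      simp only [mul_assoc]
      rw [← mul_assoc Q' (motion A B (-x) (-t)), hQT]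
      simp only [mul_assoc]
    -- Multiplication by T⁻¹ frees N from T, and Q' then reduces N = QK to K; the other term
    -- acquires T⁻², hence the arguments -2x and -2t.
    have h7 : motion A B ξ 0 * Q' * motion A B (-x) (-t) * G = motion A B ξ 0 * K +
        motion A B (-2 * x + ξ) (-2 * t) * (Q' * (M₁ * M)) := by
      rw [hGeq, mul_add]
      congr 1
      · rw [← mul_assoc, mul_assoc _ (motion A B (-x) (-t)), hinv, mul_one, hK, mul_assoc,
          ← mul_assoc Q', hQQ, one_mul]
      · rw [hmul, mul_assoc _ Q', hQT]
        simp only [mul_assoc]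
        rw [← mul_assoc Q' (motion A B (-x) (-t)), hQT]
        simp only [mul_assoc]
    have h8 : (motion A B ξ 0 * K) h + (motion A B (-2 * x + ξ) (-2 * t) * (Q' * (M₁ * M))) h =
        (motion A B (-2 * x + ξ) (-2 * t) * (Q' * (M₁ * Z))) g := by
      rw [h6, ← add_apply, ← h7, mul_apply_eq_comp, hGh]
      rfl
    have h9 : Psi A B Φ σB (Q' * (M₁ * ρ)) (-2 * x + ξ) (-2 * t) (mode B Φ g 0) =
        Φ ((motion A B (-2 * x + ξ) (-2 * t) * (Q' * (M₁ * Z))) g) := by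
      have e : Z = ρ * (adjoint Φ ∘L σB ∘L Φ) := by rw [hZ, hΦ]
      rw [e]
      simp [mode, Psi, NormedSpace.exp_zero]
    rw [h9, ← h8, map_add, neg_add_cancel_comm_assoc, mode, ← motion_time_zero A B ξ]
    rfl

end Abstract

end SolitonGLM

namespace SolitonGLM

/-! ### The adjoint of the triangular model -/

/-- Concatenation of row vectors. -/
def rowPair {α β : Type} (u : EuclideanSpace ℂ α) (v : EuclideanSpace ℂ β) :
    EuclideanSpace ℂ (α ⊕ β) :=
  WithLp.toLp 2 (Sum.elim u.ofLp v.ofLp)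

theorem rowPair_sub {α β : Type} (u u' : EuclideanSpace ℂ α)
    (v v' : EuclideanSpace ℂ β) :
    rowPair u v - rowPair u' v' = rowPair (u - u') (v - v') := by
  ext (i | i) <;> rfl

/-! ### Row vectors and block matrices -/

section RowVectors

variable {α β γ : Type} [Fintype α] [Fintype β] [Fintype γ]

theorem rowMul_mul (X : Matrix α β ℂ) (Y : Matrix β γ ℂ) (v : EuclideanSpace ℂ α) :
    rowMul (X * Y) v = rowMul Y (rowMul X v) := by
  simp [rowMul_apply, Matrix.vecMul_vecMul]

theorem inner_rowMul_right (X : Matrix α β ℂ) (u : EuclideanSpace ℂ β) (v : EuclideanSpace ℂ α) :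
    ⟪u, rowMul X v⟫_ℂ = ⟪rowMul Xᴴ u, v⟫_ℂ := by
  simp only [EuclideanSpace.inner_eq_star_dotProduct, rowMul_apply]
  rw [Matrix.star_vecMul, Matrix.conjTranspose_conjTranspose, Matrix.dotProduct_mulVec]

theorem inner_rowMul_left (X : Matrix α β ℂ) (u : EuclideanSpace ℂ α) (v : EuclideanSpace ℂ β) :
    ⟪rowMul X u, v⟫_ℂ = ⟪u, rowMul Xᴴ v⟫_ℂ := by
  rw [inner_rowMul_right, Matrix.conjTranspose_conjTranspose]

theorem isSelfAdjoint_rowMul {X : Matrix α α ℂ} (hX : Xᴴ = X) : IsSelfAdjoint (rowMul X) := by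
  rw [ContinuousLinearMap.isSelfAdjoint_iff_isSymmetric]
  intro u v
  change ⟪rowMul X u, v⟫_ℂ = ⟪u, rowMul X v⟫_ℂ
  rw [inner_rowMul_left, hX]

theorem inner_rowPair (u u' : EuclideanSpace ℂ α) (v v' : EuclideanSpace ℂ β) :
    ⟪rowPair u v, rowPair u' v'⟫_ℂ = ⟪u, u'⟫_ℂ + ⟪v, v'⟫_ℂ := by
  simp [rowPair, PiLp.inner_apply]

theorem rowMul_fromBlocks_rowPair (X : Matrix α α ℂ) (Y : Matrix α β ℂ) (Z : Matrix β α ℂ)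
    (W : Matrix β β ℂ) (u : EuclideanSpace ℂ α) (v : EuclideanSpace ℂ β) :
    rowMul (Matrix.fromBlocks X Y Z W) (rowPair u v) =
      rowPair (rowMul X u + rowMul Z v) (rowMul Y u + rowMul W v) := by
  simp only [rowMul_apply, rowPair, Matrix.vecMul_fromBlocks]
  rfl

theorem rowMul_neg (X : Matrix α β ℂ) (v : EuclideanSpace ℂ α) :
    rowMul (-X) v = -rowMul X v := by
  simp [rowMul_apply, Matrix.vecMul_neg]

theorem rowMul_zero (v : EuclideanSpace ℂ α) : rowMul (0 : Matrix α β ℂ) v = 0 := by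
  simp [rowMul_apply]

end RowVectors

/-- Fubini's theorem on the half-plane `ξ < w` for an inner product. -/
theorem integral_inner_Iio_eq_integral_inner_Ioi {F : Type*} [NormedAddCommGroup F]
    [InnerProductSpace ℂ F] [CompleteSpace F] {u v : ℝ → F} (hu : Integrable u)
    (hv : Integrable v) :
    ∫ w, ⟪∫ ξ in Set.Iio w, u ξ, v w⟫_ℂ = ∫ ξ, ⟪u ξ, ∫ w in Set.Ioi ξ, v w⟫_ℂ := by
  let k : ℝ → ℝ → ℂ := fun w ξ => (Set.Iio w).indicator (fun ξ => ⟪u ξ, v w⟫_ℂ) ξ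
  -- The indicator of the half-plane ξ < w, sliced in the other variable.
  have hk : ∀ w ξ, k w ξ = (Set.Ioi ξ).indicator (fun w => ⟪u ξ, v w⟫_ℂ) w := fun w ξ => by
    simp only [k, Set.indicator_apply, Set.mem_Iio, Set.mem_Ioi]
  have hint : Integrable (Function.uncurry k) (volume.prod volume) := by
    have h1 : Integrable (fun z : ℝ × ℝ => ‖v z.1‖ * ‖u z.2‖) (volume.prod volume) :=
      hv.norm.mul_prod hu.norm
    have h2 : AEStronglyMeasurable (fun z : ℝ × ℝ => ⟪u z.2, v z.1⟫_ℂ) (volume.prod volume) :=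
      hu.aestronglyMeasurable.comp_snd.inner hv.aestronglyMeasurable.comp_fst
    have h3 : Function.uncurry k =
        {z : ℝ × ℝ | z.2 < z.1}.indicator (fun z => ⟪u z.2, v z.1⟫_ℂ) := by
      funext z
      simp only [Function.uncurry, k, Set.indicator_apply, Set.mem_Iio, Set.mem_ofPred_eq]
    have hm : MeasurableSet {z : ℝ × ℝ | z.2 < z.1} :=
      measurableSet_lt measurable_snd measurable_fst
    rw [h3]
    refine Integrable.indicator (h1.mono' h2 (Eventually.of_forall fun z => ?_)) hm
    rw [mul_comm]
    exact norm_inner_le_norm _ _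
  have h := integral_integral_swap hint
  have hL : ∀ w, ∫ ξ, k w ξ = ⟪∫ ξ in Set.Iio w, u ξ, v w⟫_ℂ := fun w => by
    simp only [k]
    rw [integral_indicator measurableSet_Iio, ← inner_conj_symm, ← integral_inner hu.integrableOn,
      ← integral_conj]
    simp only [inner_conj_symm]
  have hR : ∀ ξ, ∫ w, k w ξ = ⟪u ξ, ∫ w in Set.Ioi ξ, v w⟫_ℂ := fun ξ => by
    simp only [hk]
    rw [integral_indicator measurableSet_Ioi, ← integral_inner hv.integrableOn]
  simpa only [hL, hR] using h

variable {l d : ℝ} {p r s : ℕ}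

theorem mem_Icc_of_mem_Delta (hd : 0 < d) (hdl : d < l) {w : ℝ} (hw : w ∈ Delta l d) :
    w ∈ Set.Icc (-l) l := by
  rcases hw with ⟨h1, h2⟩ | ⟨h1, h2⟩ <;> constructor <;> linarith

theorem coeFn_mulVar (f : HSpace l d p) :
    mulVar l d p f =ᵐ[muDelta l d] fun w => (w : ℂ) • f w := (memLp_mulFun f).coeFn_toLp

theorem integral_muDelta (F : ℝ → ℂ) :
    ∫ w, F w ∂(muDelta l d) = ∫ w, (Delta l d).indicator F w :=
  (integral_indicator (measurableSet_Delta l d)).symm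

theorem adjoint_mulVar : adjoint (mulVar l d p) = mulVar l d p := by
  refine Eq.symm ((ContinuousLinearMap.eq_adjoint_iff _ _).2 fun f g => ?_)
  rw [L2.inner_def, L2.inner_def]
  refine integral_congr_ae ?_
  filter_upwards [coeFn_mulVar f, coeFn_mulVar g] with w hf hg
  rw [hf, hg, inner_smul_left, inner_smul_right, Complex.conj_ofReal]

namespace ModelData

theorem channel_of_notMem (D : ModelData l d p r s) (f : HSpace l d p) {ξ : ℝ}
    (hξ : ξ ∉ Delta l d) : D.channel f ξ = 0 := Set.indicator_of_notMem hξ _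

/-- The channel function vanishes outside Δ ⊂ [-l, l], so the lower limit may be moved to -∞.
Half-lines are the form required by Fubini. -/
theorem intervalIntegral_channel_left (D : ModelData l d p r s) (hd : 0 < d) (hdl : d < l)
    (f : HSpace l d p) (w : ℝ) :
    ∫ ξ in (-l)..w, D.channel f ξ = ∫ ξ in Set.Iio w, D.channel f ξ := by
  have hi := D.integrable_channel f
  rw [← intervalIntegral.integral_Iic_sub_Iic hi.integrableOn hi.integrableOn,
    integral_Iic_eq_integral_Iio, integral_Iic_eq_integral_Iio (x := -l),
    setIntegral_eq_zero_of_forall_eq_zero (t := Set.Iio (-l)), sub_zero]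
  intro ξ hξ
  exact D.channel_of_notMem f fun h => (mem_Icc_of_mem_Delta hd hdl h).1.not_gt hξ

theorem intervalIntegral_channel_right (D : ModelData l d p r s) (hd : 0 < d) (hdl : d < l)
    (f : HSpace l d p) (w : ℝ) :
    ∫ ξ in w..l, D.channel f ξ = ∫ ξ in Set.Ioi w, D.channel f ξ := by
  have hi := D.integrable_channel f
  have h0 : ∫ ξ in Set.Ioi l, D.channel f ξ = 0 :=
    setIntegral_eq_zero_of_forall_eq_zero fun ξ hξ =>
      D.channel_of_notMem f fun h => (mem_Icc_of_mem_Delta hd hdl h).2.not_gt hξ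
  rw [← intervalIntegral.integral_interval_add_Ioi hi.integrableOn hi.integrableOn (b := l), h0,
    add_zero]

theorem Phi_apply (D : ModelData l d p r s) (f : HSpace l d p) :
    D.Phi f = ∫ w, D.channel f w := rfl

theorem integral_Iio_add_Ioi_channel (D : ModelData l d p r s) (f : HSpace l d p) (w : ℝ) :
    (∫ ξ in Set.Iio w, D.channel f ξ) + ∫ ξ in Set.Ioi w, D.channel f ξ = D.Phi f := by
  have hi := D.integrable_channel f
  rw [← integral_Iic_eq_integral_Iio, intervalIntegral.integral_Iic_add_Ioi hi.integrableOn
    hi.integrableOn, Phi_apply]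

theorem coeFn_volterra (D : ModelData l d p r s) {a b : ℝ → ℝ} (ha : Continuous a)
    (hb : Continuous b) (C : Matrix (Fin r ⊕ Fin s) (Fin r ⊕ Fin s) ℂ) (f : HSpace l d p) :
    D.volterra a b ha hb C f =ᵐ[muDelta l d] D.volterraFun a b C f :=
  (D.memLp_volterraFun ha hb C f).coeFn_toLp

/-- Moving CΠ* to the other argument leaves a pairing of two channel functions on the whole line,
where the kernel is triangular and Π no longer appears explicitly. -/
theorem inner_volterra (D : ModelData l d p r s) {a b : ℝ → ℝ} (ha : Continuous a)
    (hb : Continuous b) (C : Matrix (Fin r ⊕ Fin s) (Fin r ⊕ Fin s) ℂ) (f g : HSpace l d p) :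
    ⟪g, D.volterra a b ha hb C f⟫_ℂ =
      ∫ w, ⟪rowMul Cᴴ (D.channel g w), ∫ ξ in (a w)..(b w), D.channel f ξ⟫_ℂ := by
  rw [L2.inner_def]
  have h1 : ∫ w, ⟪g w, D.volterra a b ha hb C f w⟫_ℂ ∂(muDelta l d) =
      ∫ w, ⟪rowMul Cᴴ (rowMul (D.P w) (g w)), ∫ ξ in (a w)..(b w), D.channel f ξ⟫_ℂ
        ∂(muDelta l d) := by
    refine integral_congr_ae ?_
    filter_upwards [D.coeFn_volterra ha hb C f] with w hw
    rw [hw, volterraFun, inner_rowMul_right, Matrix.conjTranspose_mul,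
      Matrix.conjTranspose_conjTranspose, rowMul_mul]
  rw [h1, integral_muDelta]
  refine integral_congr_ae (Eventually.of_forall fun w => ?_)
  by_cases hw : w ∈ Delta l d
  · simp only [channel, Set.indicator_of_mem hw]
  · simp only [channel, Set.indicator_of_notMem hw, map_zero, inner_zero_left]

theorem integrable_rowMul_channel (D : ModelData l d p r s)
    (C : Matrix (Fin r ⊕ Fin s) (Fin r ⊕ Fin s) ℂ) (f : HSpace l d p) :
    Integrable fun w => rowMul C (D.channel f w) :=
  (rowMul C).integrable_comp (D.integrable_channel f)

theorem setIntegral_rowMul_channel (D : ModelData l d p r s)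
    (C : Matrix (Fin r ⊕ Fin s) (Fin r ⊕ Fin s) ℂ) (f : HSpace l d p) (s : Set ℝ) :
    ∫ w in s, rowMul C (D.channel f w) = rowMul C (∫ w in s, D.channel f w) :=
  (rowMul C).integral_comp_comm (D.integrable_channel f).integrableOn

/-- The Volterra operator `f ↦ (∫_{-l}^w f Π) C Π*(w)`. -/
abbrev volterraLeft (D : ModelData l d p r s) (C : Matrix (Fin r ⊕ Fin s) (Fin r ⊕ Fin s) ℂ) :
    HSpace l d p →L[ℂ] HSpace l d p :=
  D.volterra (fun _ => -l) (fun w => w) continuous_const continuous_id' C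

/-- The Volterra operator `f ↦ (∫_w^l f Π) C Π*(w)`. -/
abbrev volterraRight (D : ModelData l d p r s) (C : Matrix (Fin r ⊕ Fin s) (Fin r ⊕ Fin s) ℂ) :
    HSpace l d p →L[ℂ] HSpace l d p :=
  D.volterra (fun w => w) (fun _ => l) continuous_id' continuous_const C

theorem adjoint_volterraRight (D : ModelData l d p r s) (hd : 0 < d) (hdl : d < l)
    (C : Matrix (Fin r ⊕ Fin s) (Fin r ⊕ Fin s) ℂ) :
    adjoint (D.volterraRight C) = D.volterraLeft Cᴴ := by
  refine Eq.symm ((ContinuousLinearMap.eq_adjoint_iff _ _).2 fun f g => ?_)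
  rw [← inner_conj_symm, D.inner_volterra, D.inner_volterra, ← integral_conj]
  simp only [inner_conj_symm, D.intervalIntegral_channel_left hd hdl,
    D.intervalIntegral_channel_right hd hdl, Matrix.conjTranspose_conjTranspose]
  rw [← integral_inner_Iio_eq_integral_inner_Ioi (D.integrable_rowMul_channel _ _)
    (D.integrable_channel _)]
  simp only [D.setIntegral_rowMul_channel, inner_rowMul_left, Matrix.conjTranspose_conjTranspose]

theorem adjoint_volterraLeft (D : ModelData l d p r s) (hd : 0 < d) (hdl : d < l)
    (C : Matrix (Fin r ⊕ Fin s) (Fin r ⊕ Fin s) ℂ) :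
    adjoint (D.volterraLeft C) = D.volterraRight Cᴴ := by
  rw [← ContinuousLinearMap.adjoint_adjoint (D.volterraRight Cᴴ), D.adjoint_volterraRight hd hdl,
    Matrix.conjTranspose_conjTranspose]

/-- The half-lines ξ < w and ξ > w together give the full integral Φf, which no longer depends on w.
-/
theorem volterraLeft_add_volterraRight (D : ModelData l d p r s) (hd : 0 < d) (hdl : d < l)
    (C : Matrix (Fin r ⊕ Fin s) (Fin r ⊕ Fin s) ℂ) :
    D.volterraLeft C + D.volterraRight C = adjoint D.Phi ∘L rowMul C ∘L D.Phi := by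
  ext1 f
  refine ext_inner_left ℂ fun g => ?_
  rw [add_apply, inner_add_right, D.inner_volterra, D.inner_volterra, comp_apply,
    ContinuousLinearMap.adjoint_inner_right, comp_apply, inner_rowMul_right]
  simp only [D.intervalIntegral_channel_left hd hdl, D.intervalIntegral_channel_right hd hdl]
  have hi := D.integrable_rowMul_channel Cᴴ g
  -- A bound uniform in the set gives integrability of the two pairings, so that they may be added
  -- under the integral.
  have hb : ∀ s : Set ℝ, ‖∫ ξ in s, D.channel f ξ‖ ≤ ∫ ξ, ‖D.channel f ξ‖ := fun s =>
    (norm_integral_le_integral_norm _).trans (setIntegral_le_integral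
      (D.integrable_channel f).norm (Eventually.of_forall fun _ => norm_nonneg _))
  have hcL : Continuous fun w => ∫ ξ in Set.Iio w, D.channel f ξ := by
    simp only [← D.intervalIntegral_channel_left hd hdl]
    exact intervalIntegral.continuous_primitive
      (fun _ _ => (D.integrable_channel f).intervalIntegrable) _
  have hcR : Continuous fun w => ∫ ξ in Set.Ioi w, D.channel f ξ := by
    have : (fun w => ∫ ξ in Set.Ioi w, D.channel f ξ) =
        fun w => D.Phi f - ∫ ξ in Set.Iio w, D.channel f ξ := by
      funext w
      rw [← D.integral_Iio_add_Ioi_channel f w, add_sub_cancel_left]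
    rw [this]
    exact continuous_const.sub hcL
  have hint : ∀ S : ℝ → Set ℝ, (Continuous fun w => ∫ ξ in S w, D.channel f ξ) →
      Integrable fun w => ⟪rowMul Cᴴ (D.channel g w), ∫ ξ in S w, D.channel f ξ⟫_ℂ :=
    fun S hS => by
      refine (hi.norm.mul_const (∫ ξ, ‖D.channel f ξ‖)).mono'
        (hi.aestronglyMeasurable.inner hS.aestronglyMeasurable)
        (Eventually.of_forall fun w => (norm_inner_le_norm _ _).trans ?_)
      exact mul_le_mul_of_nonneg_left (hb _) (norm_nonneg _)
  rw [← integral_add (hint _ hcL) (hint _ hcR)]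
  simp only [← inner_add_right, D.integral_Iio_add_Ioi_channel]
  rw [D.Phi_apply g, ← ContinuousLinearMap.integral_comp_comm _ (D.integrable_channel g),
    ← inner_conj_symm, ← integral_inner hi, ← integral_conj]
  simp only [inner_conj_symm]

/-! ### The imaginary part of the model and the colligation relations -/

theorem conjTranspose_L (D : ModelData l d p r s) : D.Lᴴ = D.L := by
  simp only [L, J₁, J₂, S, Matrix.conjTranspose_add, Matrix.conjTranspose_sub,
    Matrix.fromBlocks_conjTranspose, Matrix.conjTranspose_zero, Matrix.conjTranspose_one,
    Matrix.conjTranspose_conjTranspose]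
  abel

/-- The two Volterra terms with S* and S are adjoint to each other, so together with multiplication
by w they form a selfadjoint operator. Only the L-term contributes, through the sum of its left and
right versions. -/
theorem im_B (D : ModelData l d p r s) (hd : 0 < d) (hdl : d < l) :
    D.B - adjoint D.B = Complex.I • (adjoint D.Phi ∘L rowMul D.L ∘L D.Phi) := by
  have hL := D.adjoint_volterraLeft hd hdl D.L
  have hS := D.adjoint_volterraLeft hd hdl D.Sᴴ
  have hS' := D.adjoint_volterraRight hd hdl D.S
  rw [D.conjTranspose_L] at hL
  rw [Matrix.conjTranspose_conjTranspose] at hS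
  rw [← D.volterraLeft_add_volterraRight hd hdl, B]
  simp only [map_add, map_sub, map_smulₛₗ, adjoint_mulVar, hL, hS, hS', Complex.conj_I]
  module

theorem PhiT_apply (D : ModelData l d p r s) (f : HSpace l d p) :
    D.PhiT f = rowPair (D.Phi f) (D.Phi (adjoint D.A f)) := by
  ext (i | i) <;> rfl

theorem sigmaA_rowPair (D : ModelData l d p r s) (u v : EuclideanSpace ℂ (Fin r ⊕ Fin s)) :
    D.sigmaA (rowPair u v) = rowPair 0 (-rowMul D.L v) := by
  simp [sigmaA, rowMul_fromBlocks_rowPair, rowMul_zero, rowMul_neg]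

theorem sigmaB_rowPair (D : ModelData l d p r s) (u v : EuclideanSpace ℂ (Fin r ⊕ Fin s)) :
    D.sigmaB (rowPair u v) = rowPair (rowMul D.L u) 0 := by
  simp [sigmaB, rowMul_fromBlocks_rowPair, rowMul_zero]

theorem gamma_rowPair (D : ModelData l d p r s) (u v : EuclideanSpace ℂ (Fin r ⊕ Fin s)) :
    D.gamma (rowPair u v) = rowPair (-rowMul D.L v) (-rowMul D.L u) := by
  simp [gamma, rowMul_fromBlocks_rowPair, rowMul_zero, rowMul_neg]

theorem adjoint_PhiT_sigmaB_PhiT (D : ModelData l d p r s) :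
    adjoint D.PhiT ∘L D.sigmaB ∘L D.PhiT = adjoint D.Phi ∘L rowMul D.L ∘L D.Phi := by
  ext1 f
  refine ext_inner_left ℂ fun g => ?_
  simp only [comp_apply, ContinuousLinearMap.adjoint_inner_right, PhiT_apply, sigmaB_rowPair,
    inner_rowPair, inner_zero_right, add_zero]

/-- The matrix σ_A sees only the second component ΦA* of Φ̃, whose adjoint supplies the factor A on
the left. -/
theorem adjoint_PhiT_sigmaA_PhiT (D : ModelData l d p r s) :
    adjoint D.PhiT ∘L D.sigmaA ∘L D.PhiT =
      -(D.A ∘L (adjoint D.Phi ∘L rowMul D.L ∘L D.Phi) ∘L adjoint D.A) := by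
  ext1 f
  refine ext_inner_left ℂ fun g => ?_
  simp only [comp_apply, neg_apply, inner_neg_right, ContinuousLinearMap.adjoint_inner_right,
    PhiT_apply, sigmaA_rowPair, inner_rowPair, inner_zero_right, zero_add]
  rw [← ContinuousLinearMap.adjoint_inner_left D.A,
    ContinuousLinearMap.adjoint_inner_right D.Phi]

theorem isRegularColligation (D : ModelData l d p r s) (hd : 0 < d) (hdl : d < l)
    (hB : IsUnit D.B) :
    IsRegularColligation D.A D.B D.PhiT D.sigmaA D.sigmaB D.gamma D.gammaT := by
  have hAB : D.A * D.B = 1 := Ring.inverse_mul_cancel _ hB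
  have hBA : D.B * D.A = 1 := Ring.mul_inverse_cancel _ hB
  have hBA' : adjoint D.B * adjoint D.A = 1 := by
    have := congrArg star hAB
    rwa [star_mul, star_one] at this
  have hAB' : adjoint D.A * adjoint D.B = 1 := by
    have := congrArg star hBA
    rwa [star_mul, star_one] at this
  have hLneg : (-D.L)ᴴ = -D.L := by rw [Matrix.conjTranspose_neg, D.conjTranspose_L]
  have hσA : IsSelfAdjoint D.sigmaA := isSelfAdjoint_rowMul (by
    rw [Matrix.fromBlocks_conjTranspose, hLneg]; simp)
  have hσB : IsSelfAdjoint D.sigmaB := isSelfAdjoint_rowMul (by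
    rw [Matrix.fromBlocks_conjTranspose, D.conjTranspose_L]; simp)
  have hγ : IsSelfAdjoint D.gamma := isSelfAdjoint_rowMul (by
    rw [Matrix.fromBlocks_conjTranspose, hLneg]; simp)
  have himB : Complex.I⁻¹ • (D.B - adjoint D.B) = adjoint D.PhiT ∘L D.sigmaB ∘L D.PhiT := by
    rw [D.im_B hd hdl, smul_smul, inv_mul_cancel₀ Complex.I_ne_zero, one_smul,
      D.adjoint_PhiT_sigmaB_PhiT]
  have himA : Complex.I⁻¹ • (D.A - adjoint D.A) = adjoint D.PhiT ∘L D.sigmaA ∘L D.PhiT := by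
    -- The resolvent-type identity for inverses carries the imaginary part of B over to A.
    have h1 : D.A - adjoint D.A = -(D.A * (D.B - adjoint D.B) * adjoint D.A) := by
      rw [mul_sub, sub_mul, hAB, one_mul, mul_assoc, hBA', mul_one, neg_sub]
    rw [h1, D.im_B hd hdl, D.adjoint_PhiT_sigmaA_PhiT, mul_smul_comm, smul_mul_assoc, smul_neg,
      smul_smul, inv_mul_cancel₀ Complex.I_ne_zero, one_smul, mul_assoc]
    rfl
  have hinput : D.sigmaA ∘L D.PhiT ∘L adjoint D.B - D.sigmaB ∘L D.PhiT ∘L adjoint D.A =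
      D.gamma ∘L D.PhiT := by
    ext1 f
    -- Thus the second component of Φ̃B*f is Φf, which produces the off-diagonal form of γ.
    have h2 : adjoint D.A (adjoint D.B f) = f := DFunLike.congr_fun hAB' f
    simp only [sub_apply, comp_apply, PhiT_apply, sigmaA_rowPair, sigmaB_rowPair, gamma_rowPair,
      rowPair_sub, h2, zero_sub, sub_zero]
  refine ⟨hAB.trans hBA.symm, hσA, hσB, hγ, ?_, himA, himB, hinput, ?_, ?_⟩
  -- The adjoint exchanges the two products, so their difference is skew-adjoint and the factor i
  -- makes it selfadjoint.
  · refine hγ.add ?_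
    rw [isSelfAdjoint_iff, star_smul]
    simp only [ContinuousLinearMap.star_eq_adjoint, map_sub, ContinuousLinearMap.adjoint_comp,
      ContinuousLinearMap.adjoint_adjoint, hσA.adjoint_eq, hσB.adjoint_eq]
    simp only [ContinuousLinearMap.comp_assoc, Complex.star_def, Complex.conj_I]
    module
  -- The output relation is the input relation after replacing B* and A* by means of their imaginary
  -- parts; the correction is exactly γ̃ - γ.
  · have hB' : D.B = adjoint D.B + Complex.I • (adjoint D.PhiT ∘L D.sigmaB ∘L D.PhiT) := by
      rw [← himB, smul_smul, mul_inv_cancel₀ Complex.I_ne_zero, one_smul, add_sub_cancel]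
    have hA' : D.A = adjoint D.A + Complex.I • (adjoint D.PhiT ∘L D.sigmaA ∘L D.PhiT) := by
      rw [← himA, smul_smul, mul_inv_cancel₀ Complex.I_ne_zero, one_smul, add_sub_cancel]
    ext1 f
    have hBf := DFunLike.congr_fun hB' f
    have hAf := DFunLike.congr_fun hA' f
    have hin := DFunLike.congr_fun hinput f
    simp only [sub_apply, add_apply, smul_apply, comp_apply] at hBf hAf hin
    simp only [gammaT, sub_apply, add_apply, smul_apply, comp_apply, hBf, hAf, map_add, map_smul]
    rw [← hin]
    module
  · rw [gammaT, add_sub_cancel_left]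

end ModelData

end SolitonGLM

end

/-! ### Solitonic combinations of the triangular model -/

theorem mainTheorem5 {l d : ℝ} (hd : 0 < d) (hdl : d < l) {p r s : ℕ}
    (D : SolitonGLM.ModelData l d p r s) (hB : IsUnit D.B)
    (U : SolitonGLM.HSpace l d p →L[ℂ] SolitonGLM.HSpace l d p)
    (hU : adjoint U ∘L U = 1) (hU' : U ∘L adjoint U = 1)
    (hBU : adjoint D.B = -(U ∘L D.B ∘L adjoint U))
    (ρ N M₁ M Bt : SolitonGLM.HSpace l d p →L[ℂ] SolitonGLM.HSpace l d p)
    (hM₁ : M₁ = adjoint U) (hM : SolitonGLM.IsStrongIntegral D.B ρ M)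
    (hNB : N ∘L D.B = D.B ∘L N) (hN : N ∘L Bt = N) (hMB : M ∘L Bt = -M)
    (hBt : Bt ∘L Bt = 1) :
    SolitonGLM.IsRegularColligation D.A D.B D.PhiT D.sigmaA D.sigmaB D.gamma D.gammaT ∧
    ∀ x t : ℝ, IsUnit (SolitonGLM.Gam D.A D.B N M₁ M x t) →
      SolitonGLM.SineGordonAt Bt (SolitonGLM.soliton D.A D.B N M₁ M) x t ∧
      ∀ g ∈ LinearMap.range (D.B - adjoint D.B).toLinearMap, ∀ h,
        h = SolitonGLM.soliton D.A D.B N M₁ M x t g - Complex.I • D.B g →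
        SolitonGLM.GLMEquation D.A D.B D.PhiT D.sigmaB (adjoint U ∘L ρ) x t (N h) h g ∧
        (N = SolitonGLM.P₁ Bt →
          SolitonGLM.GLMEquation D.A D.B D.PhiT D.sigmaB (adjoint U ∘L ρ) x t
            (SolitonGLM.P₁ Bt h) h g) ∧
        (∀ Nhat : SolitonGLM.HSpace l d p →L[ℂ] SolitonGLM.HSpace l d p, IsUnit Nhat →
          Nhat ∘L D.B = D.B ∘L Nhat → N = Nhat ∘L SolitonGLM.P₁ Bt →
          SolitonGLM.GLMEquation D.A D.B D.PhiT D.sigmaB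
            (Ring.inverse Nhat ∘L adjoint U ∘L ρ) x t (SolitonGLM.P₁ Bt h) h g) := by
  have hAB : D.A * D.B = 1 := Ring.inverse_mul_cancel _ hB
  have hBA : D.B * D.A = 1 := Ring.mul_inverse_cancel _ hB
  have hcol := D.isRegularColligation hd hdl hB
  have hMB' : M₁ * adjoint D.B = -(D.B * M₁) := by
    have h : adjoint U * U = 1 := hU
    have h' : adjoint D.B = -(U * (D.B * adjoint U)) := hBU
    rw [hM₁, h', mul_neg, ← mul_assoc, h, one_mul]
  have hMA : M₁ * adjoint D.A = -(D.A * M₁) := by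
    have h : adjoint D.B * adjoint D.A = 1 := by
      have := congrArg star hAB
      rwa [star_mul, star_one] at this
    -- The relation for B, multiplied by A on the left and by A* on the right, becomes the relation
    -- for A.
    have h1 : D.A * (M₁ * adjoint D.B) * adjoint D.A = -(M₁ * adjoint D.A) := by
      rw [hMB', mul_neg, ← mul_assoc, hAB, one_mul, neg_mul]
    rw [← mul_assoc, mul_assoc _ (adjoint D.B), h, mul_one] at h1
    rw [h1, neg_neg]
  have hcomm : Commute D.A D.B := hAB.trans hBA.symm
  have hadj : adjoint U ∘L ρ = M₁ * ρ := by rw [hM₁]; rfl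
  refine ⟨hcol, fun x t hG => ⟨?_, fun g _ h hh => ?_⟩⟩
  · exact SolitonGLM.sineGordonAt_of_hasDerivAt hAB hBA hBt
      (SolitonGLM.hasDerivAt_Gam_space hcomm hMB' hN hMB)
      (SolitonGLM.hasDerivAt_Gam_time hcomm hMA hN hMB) hG
  · have h1 : SolitonGLM.GLMEquation D.A D.B D.PhiT D.sigmaB (adjoint U ∘L ρ) x t (N h) h g := by
      -- The trivial factorization N = 1·N gives the equation for Nh; the last claim uses Q = N̂, K
      -- = P₁ instead.
      have := SolitonGLM.glmEquation_of_factor (Q := 1) (Q' := 1) (K := N) hAB hBA hMA hMB'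
        hcol.im_B hM hNB hN hMB (one_mul 1) (Commute.one_left _) (Commute.one_left _)
        (one_mul N).symm hG g h hh
      rwa [one_mul, ← hadj] at this
    refine ⟨h1, fun hNP => by rwa [hNP] at h1, fun Nhat hu hcN hNP => ?_⟩
    rw [hadj]
    -- Here `D.A` unfolds to the ring inverse of `D.B`, and inverses of commuting operators commute.
    have hA' : Commute (Ring.inverse Nhat) D.A := Commute.ringInverse_ringInverse hcN
    have hB' : Commute (Ring.inverse Nhat) D.B := by
      obtain ⟨u, rfl⟩ := hu
      rw [Ring.inverse_unit]
      exact Commute.units_inv_left hcN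
    exact SolitonGLM.glmEquation_of_factor hAB hBA hMA hMB' hcol.im_B hM hNB hN hMB
      (Ring.inverse_mul_cancel _ hu) hA' hB' hNP hG g h hh
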